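/- **Setting.** Let $\mathcal S,\mathcal A$ be finite, $\mathcal T=(\mathcal S\times\mathcal A)^H$, and consider a finite-horizon MDP (initial law, transition kernels $P_h$) with history-dependent randomized policies; $J(\pi;r)=\mathbb E_{\tau\sim\pi}[r(\tau)]$. There are $N\ge 1$ users with data $\hat{\mathcal D}_i=(o_i^{(j)},\tau_{i,0}^{(j)},\tau_{i,1}^{(j)})_{j\le N_p}$, all samples independent, $\tau_{i,0}^{(j)}\sim\mu_0$, $\tau_{i,1}^{(j)}\sim\mu_1$, and $o_i^{(j)}\sim P_{r_i^\star}(\cdot\mid\tau_{i,0}^{(j)},\tau_{i,1}^{(j)})$, where $P_r(0\mid\tau_0,\tau_1)=\Phi(r(\tau_0)-r(\tau_1))=1-P_r(1\mid\tau_0,\tau_1)$; $\mathcal D_i$ is the law of one sample of user $i$. Here $\Phi>0$ is $C^1$, nondecreasing, $\Phi(x)+\Phi(-x)=1$, and $\Phi'>0$ on $[-2R_{\max},2R_{\max}]$; $\kappa=(\min_{[-2R_{\max},2R_{\max}]}\Phi')^{-1}$ and $\xi=\max_{[-2R_{\max},2R_{\max}]}|\Phi'/\Phi|$. Let $\phi:\mathcal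 T\to\mathbb R^d$, $\Psi=\{\psi_\omega:\mathbb R^d\to\mathbb R^k\}_{\omega\in\Omega}$, $k\ge1$, $B>0$, $R_{\max}>0$, $r_{\omega,\theta}(\tau)=\langle\psi_\omega(\phi(\tau)),\theta\rangle$, $\mathcal G_{\mathbf r}=\{(r_{\omega,\theta_i})_{i\le N}:\omega\in\Omega,\ \|\theta_i\|_2\le B\}$, $\mathcal G_{\psi_\omega}=\{r_{\omega,\theta}:\|\theta\|_2\le B\}$. All rewards in these classes take values in $[-R_{\max},R_{\max}]$. Write $\Delta_\omega(\tau_0,\tau_1)=\psi_\omega(\phi(\tau_0))-\psi_\omega(\phi(\tau_1))$. The bracketing number $\mathcal N_{\mathcal G}(\varepsilon)$ of a class of reward vectors is the least number of pairs $(g_1,g_2)$ of maps from trajectory pairs to vectors indexed by (user, outcome), with $g_1\le g_2$ and $\|g_1-g_2\|_1\le\varepsilon$ at every trajectory pair, such that for every $\mathbf r\in\mathcal G$ some pair satisfies $g_1\le P_{\mathbf r}\le g_2$ at every trajectory pair. For laws $D,D'$ of $(o,\tau_0,\tau_1)$, $\mathrm{disc}(D,D',\mathcal G)=\sup_{r\in\mathcal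 G}|\mathbb E_D\log P_r(o\mid\tau_0,\tau_1)-\mathbb E_{D'}\log P_r(o\mid\tau_0,\tau_1)|$. The concentrability coefficient is $$C_r(\mathcal G_{\mathbf r},\pi,\mu,i)=\max\Big\{0,\sup_{\mathbf r\in\mathcal G_{\mathbf r}}\frac{\mathbb E_{\tau_0\sim\pi,\tau_1\sim\mu}[r_i^\star(\tau_0)-r_i^\star(\tau_1)-r_i(\tau_0)+r_i(\tau_1)]}{\sqrt{\mathbb E_{\tau_0\sim\mu_0,\tau_1\sim\mu_1}|r_i^\star(\tau_0)-r_i^\star(\tau_1)-r_i(\tau_0)+r_i(\tau_1)|^2}}\Big\}\in[0,\infty]$$ (a ratio with zero denominator is $+\infty$ if the numerator is positive and is ignored otherwise). **Clustering algorithm.** (1) $(\hat\omega,\cdot)$ is a joint maximizer of $\sum_{i}\sum_j\log P_{r_{\omega,\theta_i}}(o_i^{(j)}\mid\tau_{i,0}^{(j)},\tau_{i,1}^{(j)})$ over $\omega\in\Omega$, $\|\theta_i\|_2\le B$. (2) $(\hat\theta_{(l)})_{l\le K}$ maximizes $\sum_i\max_{l\le K}\sum_j\log P_{r_{\hat\omega,\theta_{(l)}}}(o_i^{(j)}\mid\tau_{i,0}^{(j)},\tau_{i,1}^{(j)})$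 over $\|\theta_{(l)}\|_2\le B$, and $\hat f(i)$ attains the inner maximum at $(\hat\theta_{(l)})_l$. (3) $\hat\pi_{(l)}$ maximizes $J(\pi;r_{\hat\omega,\hat\theta_{(l)}})-\mathbb E_{\mu_1}[r_{\hat\omega,\hat\theta_{(l)}}]$ over all policies. For $i\le N$, $\mathcal C_{\hat f(i)}$ denotes the uniform mixture of the $\mathcal D_j$ with $\hat f(j)=\hat f(i)$. **Assumptions**, with constants $c_0,c_1>0$ and $C'_{\max}$: 1. (Realizability) $r_i^\star=r_{\omega^\star,\theta_i^\star}$ with $\omega^\star\in\Omega$ and $\|\theta_i^\star\|_2<B$ for all $i$; write $\psi^\star=\psi_{\omega^\star}$. 2. (Diversity) $\sigma_k^2([\theta_1^\star,\dots,\theta_N^\star])\ge c_0N/k$, where $\sigma_k$ is the $k$-th largest singular value. 3. (Uniqueness of the representation) For all $\omega,\omega'\in\Omega$, $\varepsilon>0$, $T\ge1$ and $v_1,\dots,v_T,v_1',\dots,v_T'\in\mathbb R^k$ with $\sigma_k^2([v_1,\dots,v_T])\ge c_0T/k$ and $\|v_i\|_2\le B$: if $\frac1T\sum_i\mathbb E_{\tau_0\sim\mu_0,\tau_1\sim\mu_1}|\langle\Delta_\omega,v_i\rangle-\langle\Delta_{\omega'},v_i'\rangle|^2\le\varepsilon$,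 then some orthogonal matrix $P$ satisfies $\|\Delta_\omega(\tau_0,\tau_1)-P\Delta_{\omega'}(\tau_0,\tau_1)\|^2\le c_1k\varepsilon/B$ for all $\tau_0,\tau_1$. 4. (Uniform concentration) With $\Sigma_{\omega,\omega'}=\mathbb E_{\mu_0,\mu_1}[\Delta_\omega\Delta_{\omega'}^\top]$ and $\Lambda_{\omega,\omega'}=\begin{pmatrix}\Sigma_{\omega,\omega}&\Sigma_{\omega,\omega'}\\\Sigma_{\omega',\omega}&\Sigma_{\omega',\omega'}\end{pmatrix}$: for every $\delta'\in(0,1]$ and all sufficiently large $n$, the empirical version $\hat\Lambda$ from $n$ independent pairs satisfies, with probability at least $1-\delta'$, $1.1\Lambda_{\omega,\omega'}\succeq\hat\Lambda_{\omega,\omega'}\succeq0.9\Lambda_{\omega,\omega'}$ for all $\omega,\omega'\in\Omega$. 5. $C_r(\mathcal G_{\mathbf r},\pi,\mu_{i,\mathrm{ref}},i)\le C'_{\max}$ for all policies $\pi$ and all $i\le N$, where $\mu_{i,\mathrm{ref}}$ are given trajectory laws. **Theorem.** For every $R_{\max},B,c_0,c_1>0$, $C'_{\max}$ and $\xi_{\max}$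 there is a constant $c>0$, depending only on these numbers, such that the following holds in every setting as above with $\xi\le\xi_{\max}$, $K\ge1$, $N_p\ge k$. For all comparator policies $\pi_{i,\mathrm{tar}}$ and all $\delta\in(0,1]$, with probability at least $1-\delta$ over the data, every output of the clustering algorithm satisfies $$\sum_{i\le N}\big(J(\pi_{i,\mathrm{tar}};r_i^\star)-J(\hat\pi_{(\hat f(i))};r_i^\star)\big)\le cN\kappa\Bigg(\frac{\log(2K/\delta)}{N_p}+\frac{kK\log(N_p/k)}{N_p}+\frac{k\xi^2\kappa^2\log(\mathcal N_{\mathcal G_{\mathbf r}}(\tfrac1{NN_p})/\delta)}{NN_p}+\Big(\frac1N\sum_{i\le N}\mathrm{disc}(\mathcal D_i,\mathcal C_{\hat f(i)},\mathcal G_{\psi^\star})\Big)^2+\Big(\frac{\log(\mathcal N_{\mathcal G_{\psi^\star}}(\tfrac1{NN_p})/\delta)}{NN_p}\Big)^2\Bigg)^{1/4}.$$ -/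

import Mathlib

open scoped ENNReal BigOperators

noncomputable section

namespace PersonalizedRLHF

/-! ### Finite expectations, trajectories, Markov decision processes, policies -/

/-- Expectation of a real function under a probability mass function on a finite type. -/
def expect {X : Type*} [Fintype X] (p : PMF X) (g : X → ℝ) : ℝ :=
  ∑ x, (p x).toReal * g x

/-- Trajectories `(s₁, a₁, …, s_H, a_H)`. -/
def Traj (S A : Type*) (H : ℕ) : Type _ := Fin H → S × A

instance {S A : Type*} [Fintype S] [Fintype A] {H : ℕ} : Fintype (Traj S A H) :=
  inferInstanceAs (Fintype (Fin H → S × A))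

/-- Trajectories form a finite set; every subset is measurable. -/
instance {S A : Type*} {H : ℕ} : MeasurableSpace (Traj S A H) := ⊤

/-- History dependent policies: the action at a step has a law depending on the previous
state-action pairs and on the current state. -/
def Policy (S A : Type*) (H : ℕ) : Type _ :=
  (h : Fin H) → (Fin (h : ℕ) → S × A) → S → PMF A

/-- The reward-free part of a finite-horizon Markov decision process. -/
structure MDP (S A : Type*) (H : ℕ) where
  /-- law of the first state -/
  init : PMF S
  /-- transition probabilities `P_h` -/
  trans : Fin H → S → A → PMF S

namespace MDP

variable {S A : Type*} {H : ℕ}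

/-- The law of the state at (zero-based) step `n`, given the first `n` state-action pairs. -/
def nextState (M : MDP S A H) : (n : ℕ) → n < H → (Fin n → S × A) → PMF S
  | 0, _, _ => M.init
  | n + 1, h, x => M.trans ⟨n, by omega⟩ (x (Fin.last n)).1 (x (Fin.last n)).2

/-- The law of the first `n` state-action pairs under a policy. -/
def prefixLaw (M : MDP S A H) (π : Policy S A H) : (n : ℕ) → n ≤ H → PMF (Fin n → S × A)
  | 0, _ => PMF.pure (fun i => i.elim0)
  | n + 1, h =>
    (M.prefixLaw π n (by omega)).bind fun x =>
      (M.nextState n (by omega) x).bind fun s =>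
        (π ⟨n, by omega⟩ x s).bind fun a =>
          PMF.pure (Fin.snoc (α := fun _ => S × A) x (s, a))

/-- The trajectory occupancy measure `d_π`. -/
def occupancy (M : MDP S A H) (π : Policy S A H) : PMF (Traj S A H) :=
  M.prefixLaw π H le_rfl

/-- The expected cumulative reward `J(π; r)`. -/
def J [Fintype S] [Fintype A] (M : MDP S A H) (π : Policy S A H) (r : Traj S A H → ℝ) : ℝ :=
  expect (M.occupancy π) r

end MDP

/-! ### Preferences -/

/-- A function relating reward differences to preference probabilities. -/
structure Link where
  toFun : ℝ → ℝ
  monotone' : Monotone toFun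
  symm' : ∀ x, toFun x + toFun (-x) = 1
  pos' : ∀ x, 0 < toFun x
  contDiff' : ContDiff ℝ 1 toFun

instance : CoeFun Link (fun _ => ℝ → ℝ) := ⟨Link.toFun⟩

/-- `κ = (min_{[-2R, 2R]} Φ')⁻¹`. -/
def Link.kappa (Φ : Link) (R : ℝ) : ℝ :=
  (sInf (deriv Φ '' Set.Icc (-(2 * R)) (2 * R)))⁻¹

/-- `ξ = max_{[-2R, 2R]} |Φ' / Φ|`. -/
def Link.xi (Φ : Link) (R : ℝ) : ℝ :=
  sSup ((fun x => |deriv Φ x / Φ x|) '' Set.Icc (-(2 * R)) (2 * R))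

/-- `P_r(o ∣ τ₀, τ₁)`: the outcome `o = 0` means that `τ₀` is preferred to `τ₁`. -/
def prefProb {T : Type*} (Φ : Link) (r : T → ℝ) (o : Fin 2) (τ₀ τ₁ : T) : ℝ :=
  if o = 0 then Φ (r τ₀ - r τ₁) else 1 - Φ (r τ₀ - r τ₁)

theorem sum_ofReal_prefProb {T : Type*} (Φ : Link) (r : T → ℝ) (τ₀ τ₁ : T) :
    ∑ o, ENNReal.ofReal (prefProb Φ r o τ₀ τ₁) = 1 := by
  have h0 := Φ.pos' (r τ₀ - r τ₁)
  have h1 := Φ.pos' (-(r τ₀ - r τ₁))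
  have h2 := Φ.symm' (r τ₀ - r τ₁)
  rw [Fin.sum_univ_two, ← ENNReal.ofReal_add]
  · simp [prefProb]
  · simpa [prefProb] using h0.le
  · simp only [prefProb]
    norm_num
    linarith

/-- The law of the outcome of comparing two trajectories. -/
def outcome {T : Type*} (Φ : Link) (r : T → ℝ) (τ₀ τ₁ : T) : PMF (Fin 2) :=
  PMF.ofFintype (fun o => ENNReal.ofReal (prefProb Φ r o τ₀ τ₁)) (sum_ofReal_prefProb Φ r τ₀ τ₁)

/-- The `ε`-bracketing number of a class of reward vectors: the least number of pairs `(g₁, g₂)` of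
maps from trajectory pairs to vectors indexed by users and outcomes, with `g₁ ≤ g₂` and
`‖g₁ - g₂‖₁ ≤ ε` at every trajectory pair, such that the preference probability vector of every
member of the class lies between the two components of one pair. -/
def bracketingNumber {ι T : Type*} [Fintype ι] (Φ : Link) (G : Set (ι → T → ℝ)) (ε : ℝ) : ℕ :=
  sInf {n : ℕ | ∃ g₁ g₂ : Fin n → T → T → ι → Fin 2 → ℝ,
    (∀ b τ₀ τ₁, (∀ i o, g₁ b τ₀ τ₁ i o ≤ g₂ b τ₀ τ₁ i o) ∧
      ∑ i, ∑ o, |g₁ b τ₀ τ₁ i o - g₂ b τ₀ τ₁ i o| ≤ ε) ∧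
    ∀ r ∈ G, ∃ b, ∀ τ₀ τ₁ i o,
      g₁ b τ₀ τ₁ i o ≤ prefProb Φ (r i) o τ₀ τ₁ ∧ prefProb Φ (r i) o τ₀ τ₁ ≤ g₂ b τ₀ τ₁ i o}

/-- The label discrepancy of two laws of `(o, τ₀, τ₁)` with respect to a class of rewards. -/
def labelDisc {T : Type*} [Fintype T] (Φ : Link) (p q : PMF (Fin 2 × T × T))
    (G : Set (T → ℝ)) : ℝ :=
  sSup ((fun r => |expect p (fun z => Real.log (prefProb Φ r z.1 z.2.1 z.2.2))
    - expect q (fun z => Real.log (prefProb Φ r z.1 z.2.1 z.2.2))|) '' G)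

/-- `σ_k²(W)` for the `k × n` matrix `W` with columns `v₁, …, v_n`, where `σ_k` is the `k`-th
largest singular value (Mathlib numbers singular values from `0`). -/
def sigmaSq {k n : ℕ} (v : Fin n → EuclideanSpace ℝ (Fin k)) : ℝ :=
  ((Matrix.toEuclideanLin (𝕜 := ℝ) (Matrix.of fun a i => v i a)).singularValues (k - 1)) ^ 2

/-! ### The model -/

/-- The data of the problem with `N` users: the decision process, the link function, the feature
map, the family of representation functions indexed by `Ω`, the sampling laws `μ₀`, `μ₁`, the
reference laws `μ_{i,ref}`, and the true parameters. -/
structure Model (S A Ω : Type*) (H N d k : ℕ) where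
  mdp : MDP S A H
  Φ : Link
  φ : Traj S A H → EuclideanSpace ℝ (Fin d)
  ψ : Ω → EuclideanSpace ℝ (Fin d) → EuclideanSpace ℝ (Fin k)
  μ₀ : PMF (Traj S A H)
  μ₁ : PMF (Traj S A H)
  μref : Fin N → PMF (Traj S A H)
  ωstar : Ω
  θstar : Fin N → EuclideanSpace ℝ (Fin k)

/-- A preference data set: `N_p` triples `(o, τ₀, τ₁)` for each of `N` users. -/
abbrev Dataset (S A : Type*) (H N Np : ℕ) : Type _ :=
  Fin N → Fin Np → Fin 2 × Traj S A H × Traj S A H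

/-- What the clustering algorithm returns. -/
structure ClusterOutput (S A Ω : Type*) (H N K k : ℕ) where
  ω : Ω
  θ : Fin K → EuclideanSpace ℝ (Fin k)
  f : Fin N → Fin K
  π : Fin K → Policy S A H

namespace Model

variable {S A Ω : Type*} {H N d k : ℕ} (M : Model S A Ω H N d k)

/-- `r_{ω,θ}(τ) = ⟨ψ_ω(φ(τ)), θ⟩`. -/
def reward (ω : Ω) (θ : EuclideanSpace ℝ (Fin k)) (τ : Traj S A H) : ℝ :=
  inner ℝ (M.ψ ω (M.φ τ)) θ

/-- The true reward of user `i`. -/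
def rstar (i : Fin N) : Traj S A H → ℝ := M.reward M.ωstar (M.θstar i)

/-- The class of reward vectors. -/
def rewardClass (B : ℝ) : Set (Fin N → Traj S A H → ℝ) :=
  {r | ∃ ω, ∃ θ : Fin N → EuclideanSpace ℝ (Fin k),
    (∀ i, ‖θ i‖ ≤ B) ∧ r = fun i => M.reward ω (θ i)}

/-- The class of rewards with the fixed representation `ψ_ω`. -/
def fixedRepClass (B : ℝ) (ω : Ω) : Set (Traj S A H → ℝ) :=
  {r | ∃ θ : EuclideanSpace ℝ (Fin k), ‖θ‖ ≤ B ∧ r = M.reward ω θ}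

/-- The same class, regarded as a class of reward vectors of length one. -/
def fixedRepClassVec (B : ℝ) (ω : Ω) : Set (Unit → Traj S A H → ℝ) :=
  {r | r () ∈ M.fixedRepClass B ω}

/-- `ψ_ω(φ(τ₀)) - ψ_ω(φ(τ₁))`. -/
def repDiff (ω : Ω) (τ₀ τ₁ : Traj S A H) : EuclideanSpace ℝ (Fin k) :=
  M.ψ ω (M.φ τ₀) - M.ψ ω (M.φ τ₁)

/-- The law of one preference sample `(o, τ₀, τ₁)` of user `i`: independent `τ₀ ∼ μ₀`, `τ₁ ∼ μ₁`,
and `o ∼ P_{r_i^⋆}(· ∣ τ₀, τ₁)`. -/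
def userLaw (i : Fin N) : PMF (Fin 2 × Traj S A H × Traj S A H) :=
  M.μ₀.bind fun τ₀ => M.μ₁.bind fun τ₁ =>
    (outcome M.Φ (M.rstar i) τ₀ τ₁).bind fun o => PMF.pure (o, τ₀, τ₁)

/-- The pooled law of the users in the cluster of user `i`. -/
def clusterLaw {K : ℕ} (f : Fin N → Fin K) (i : Fin N) :
    PMF (Fin 2 × Traj S A H × Traj S A H) :=
  (PMF.uniformOfFinset (Finset.univ.filter fun j => f j = f i) ⟨i, by simp⟩).bind M.userLaw

/-- The law of the data set: all samples are independent. -/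
def dataLaw (Np : ℕ) : MeasureTheory.Measure (Dataset S A H N Np) :=
  MeasureTheory.Measure.pi fun i => MeasureTheory.Measure.pi fun _ => (M.userLaw i).toMeasure

/-- Log-likelihood of the samples of user `i` under the reward `r_{ω,θ}`. -/
def logLik {Np : ℕ} (D : Dataset S A H N Np) (i : Fin N) (ω : Ω)
    (θ : EuclideanSpace ℝ (Fin k)) : ℝ :=
  ∑ j, Real.log (prefProb M.Φ (M.reward ω θ) (D i j).1 (D i j).2.1 (D i j).2.2)

/-- `(ω, θ)` is a joint maximum likelihood estimate (representation learning step). -/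
def IsJointMLE {Np : ℕ} (B : ℝ) (D : Dataset S A H N Np) (ω : Ω)
    (θ : Fin N → EuclideanSpace ℝ (Fin k)) : Prop :=
  (∀ i, ‖θ i‖ ≤ B) ∧
  ∀ (ω' : Ω) (θ' : Fin N → EuclideanSpace ℝ (Fin k)), (∀ i, ‖θ' i‖ ≤ B) →
    ∑ i, M.logLik D i ω' (θ' i) ≤ ∑ i, M.logLik D i ω (θ i)

variable [Fintype S] [Fintype A]

/-- `out` is an output of the clustering algorithm on the data set `D`. -/
structure IsOutput {Np K : ℕ} (B : ℝ) (D : Dataset S A H N Np)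
    (out : ClusterOutput S A Ω H N K k) : Prop where
  /-- the representation comes from the joint maximum likelihood estimate -/
  rep : ∃ θ, M.IsJointMLE B D out.ω θ
  /-- the cluster parameters are feasible -/
  feasible : ∀ l, ‖out.θ l‖ ≤ B
  /-- the cluster parameters maximize `∑ᵢ max_l ∑ⱼ log P` -/
  optimal : ∀ θ' : Fin K → EuclideanSpace ℝ (Fin k), (∀ l, ‖θ' l‖ ≤ B) →
    ∑ i, (⨆ l, M.logLik D i out.ω (θ' l)) ≤ ∑ i, (⨆ l, M.logLik D i out.ω (out.θ l))
  /-- each user is assigned to a best cluster -/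
  assign : ∀ i l, M.logLik D i out.ω (out.θ l) ≤ M.logLik D i out.ω (out.θ (out.f i))
  /-- the policy of each cluster is optimal for the reward of the cluster -/
  policy : ∀ (l : Fin K) (π : Policy S A H),
    M.mdp.J π (M.reward out.ω (out.θ l)) - expect M.μ₁ (M.reward out.ω (out.θ l)) ≤
    M.mdp.J (out.π l) (M.reward out.ω (out.θ l)) - expect M.μ₁ (M.reward out.ω (out.θ l))

/-- The concentrability coefficient `C_r(𝒢, π, μ, i)`, with values in `[0, ∞]`; taking `ofReal` of
the numerator is the maximum with `0`; `0 / 0 = 0` and `x / 0 = ∞` for `x > 0`. -/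
def concentrability (G : Set (Fin N → Traj S A H → ℝ)) (π : Policy S A H)
    (μ : PMF (Traj S A H)) (i : Fin N) : ℝ≥0∞ :=
  ⨆ r ∈ G,
    ENNReal.ofReal (expect (M.mdp.occupancy π) fun τ₀ => expect μ fun τ₁ =>
      M.rstar i τ₀ - M.rstar i τ₁ - r i τ₀ + r i τ₁) /
    ENNReal.ofReal (√(expect M.μ₀ fun τ₀ => expect M.μ₁ fun τ₁ =>
      |M.rstar i τ₀ - M.rstar i τ₁ - r i τ₀ + r i τ₁| ^ 2))

/-- Uniqueness of the representation up to an orthonormal transformation, with constants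
`c₀` (nondegeneracy of the `v_i`) and `c₁` (conclusion). -/
def UniqueRep (B c₀ c₁ : ℝ) : Prop :=
  ∀ (ω ω' : Ω) (ε : ℝ), 0 < ε → ∀ (n : ℕ), 0 < n →
    ∀ v v' : Fin n → EuclideanSpace ℝ (Fin k),
    c₀ * n / k ≤ sigmaSq v → (∀ i, ‖v i‖ ≤ B) →
    (1 / (n : ℝ)) * ∑ i, (expect M.μ₀ fun τ₀ => expect M.μ₁ fun τ₁ =>
      (inner ℝ (M.repDiff ω τ₀ τ₁) (v i) - inner ℝ (M.repDiff ω' τ₀ τ₁) (v' i)) ^ 2) ≤ ε →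
    ∃ P : EuclideanSpace ℝ (Fin k) ≃ₗᵢ[ℝ] EuclideanSpace ℝ (Fin k), ∀ τ₀ τ₁,
      ‖M.repDiff ω τ₀ τ₁ - P (M.repDiff ω' τ₀ τ₁)‖ ^ 2 ≤ c₁ * k * ε / B

/-- The covariance `Σ_{ψ_ω, ψ_ω'}(μ₀, μ₁)`. -/
def cov (ω ω' : Ω) : Matrix (Fin k) (Fin k) ℝ :=
  Matrix.of fun a b => expect M.μ₀ fun τ₀ => expect M.μ₁ fun τ₁ =>
    M.repDiff ω τ₀ τ₁ a * M.repDiff ω' τ₀ τ₁ b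

/-- The symmetric covariance `Λ_{ψ_ω, ψ_ω'}(μ₀, μ₁)`. -/
def symCov (ω ω' : Ω) : Matrix (Fin k ⊕ Fin k) (Fin k ⊕ Fin k) ℝ :=
  Matrix.fromBlocks (M.cov ω ω) (M.cov ω ω') (M.cov ω' ω) (M.cov ω' ω')

/-- The empirical covariance of a sample of `n` trajectory pairs. -/
def empCov {n : ℕ} (x : Fin n → Traj S A H × Traj S A H) (ω ω' : Ω) :
    Matrix (Fin k) (Fin k) ℝ :=
  Matrix.of fun a b => (1 / (n : ℝ)) * ∑ j,
    M.repDiff ω (x j).1 (x j).2 a * M.repDiff ω' (x j).1 (x j).2 b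

/-- The empirical symmetric covariance. -/
def empSymCov {n : ℕ} (x : Fin n → Traj S A H × Traj S A H) (ω ω' : Ω) :
    Matrix (Fin k ⊕ Fin k) (Fin k ⊕ Fin k) ℝ :=
  Matrix.fromBlocks (M.empCov x ω ω) (M.empCov x ω ω') (M.empCov x ω' ω) (M.empCov x ω' ω')

/-- Uniform concentration of the representation covariances. -/
def UniformConcentration : Prop :=
  ∀ δ : ℝ, 0 < δ → δ ≤ 1 → ∃ n₀ : ℕ, ∀ n ≥ n₀,
    ENNReal.ofReal (1 - δ) ≤
      (MeasureTheory.Measure.pi fun _ : Fin n => M.μ₀.toMeasure.prod M.μ₁.toMeasure)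
        {x | ∀ ω ω', ((1.1 : ℝ) • M.symCov ω ω' - M.empSymCov x ω ω').PosSemidef ∧
          (M.empSymCov x ω ω' - (0.9 : ℝ) • M.symCov ω ω').PosSemidef}

/-- The right-hand side of the bound, without the leading constant, for the user-to-cluster
map `f`. -/
def boundRHS {K : ℕ} (Np : ℕ) (R B δ : ℝ) (f : Fin N → Fin K) : ℝ :=
  N * M.Φ.kappa R *
    (Real.log (2 * K / δ) / Np
      + k * K * Real.log ((Np : ℝ) / k) / Np
      + k * M.Φ.xi R ^ 2 * M.Φ.kappa R ^ 2 *
          Real.log (bracketingNumber M.Φ (M.rewardClass B) (1 / ((N : ℝ) * Np)) / δ) / (N * Np)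
      + (∑ i, (1 / (N : ℝ)) *
          labelDisc M.Φ (M.userLaw i) (M.clusterLaw f i) (M.fixedRepClass B M.ωstar)) ^ 2
      + (Real.log (bracketingNumber M.Φ (M.fixedRepClassVec B M.ωstar)
          (1 / ((N : ℝ) * Np)) / δ) / (N * Np)) ^ 2) ^ (1 / 4 : ℝ)

end Model

end PersonalizedRLHF

end

namespace PersonalizedRLHF

/-! ### Finite expectations -/

section Expect

variable {X Y : Type*} [Fintype X] [Fintype Y]

/-! Everything takes place on one event: the empirical log-likelihood is uniformly close to its mean
over the joint reward class, with error of order `√(N Np Λ)`, and any reward vector at least as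
likely as the truth has total squared probability error of order `Λ / Np`
(`Model.ofReal_one_sub_le_dataLaw`). Here `Λ` is the logarithm of the bracketing number over `δ`, up
to a factor 3 inside the logarithm. The second, faster rate comes from the half-power moment of the
likelihood ratio, which is a Hellinger affinity.

On this event the joint MLE is close to the truth, so diversity and uniqueness make the learned
representation a rotation `P` of the true one, up to `η ∼ κ √(k Λ / (N Np))`. By averaging, each
nonempty cluster has a member whose true parameter serves the whole cluster up to the discrepancies
(`Model.exists_representatives`). Pulled back by `P`, these parameters compete in the clustering
step, so the output has small mean Kullback–Leibler loss, hence small squared reward error by the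
strict slope of `Φ`; Cauchy–Schwarz over the users sums the square roots (`Model.sum_regret_le`).

Passing from reward error to regret needs both signs of the error, while concentrability bounds only
one. The other sign is obtained by reflecting the parameter through `θstar i`, an interior point of
the ball; this works inside the true representation, and the rotation leads there
(`Model.regret_le`).

With `d` the mean discrepancy and `q = ξ κ √(k Λ / (N Np))`, the regret per user is of order `κ (√(d
+ q) + q)`. For `q ≤ 1` this is at most a multiple of `κ (d² + q²)^(1/4)`. If `q > 1`, the trivial
bound `2R ≤ κ / 2` suffices. If a single bracket covers the class, `log (n / δ)` may vanish, but
then the true rewards are almost constant and the term `log (2K / δ) / Np` pays. -/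

theorem sum_toReal_pmf (p : PMF X) : ∑ x, (p x).toReal = 1 := by
  rw [← ENNReal.toReal_sum fun x _ => p.apply_ne_top x, ← tsum_fintype (L := .unconditional X),
    p.tsum_coe, ENNReal.toReal_one]

theorem expect_mono (p : PMF X) {g h : X → ℝ} (H : ∀ x, g x ≤ h x) : expect p g ≤ expect p h :=
  Finset.sum_le_sum fun x _ => mul_le_mul_of_nonneg_left (H x) ENNReal.toReal_nonneg

theorem expect_const (p : PMF X) (c : ℝ) : expect p (fun _ => c) = c := by
  simp [expect, ← Finset.sum_mul, sum_toReal_pmf]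

theorem expect_add (p : PMF X) (g h : X → ℝ) :
    expect p (fun x => g x + h x) = expect p g + expect p h := by
  simp [expect, mul_add, Finset.sum_add_distrib]

theorem expect_sub (p : PMF X) (g h : X → ℝ) :
    expect p (fun x => g x - h x) = expect p g - expect p h := by
  simp [expect, mul_sub, Finset.sum_sub_distrib]

theorem expect_const_mul (p : PMF X) (c : ℝ) (g : X → ℝ) :
    expect p (fun x => c * g x) = c * expect p g := by
  simp only [expect, Finset.mul_sum]
  exact Finset.sum_congr rfl fun x _ => by ring

theorem expect_nonneg (p : PMF X) {g : X → ℝ} (h : ∀ x, 0 ≤ g x) : 0 ≤ expect p g :=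
  Finset.sum_nonneg fun x _ => mul_nonneg ENNReal.toReal_nonneg (h x)

theorem expect_le_of_le (p : PMF X) {g : X → ℝ} {c : ℝ} (h : ∀ x, g x ≤ c) : expect p g ≤ c :=
  (expect_mono p h).trans_eq (expect_const p c)

theorem le_expect_of_le (p : PMF X) {g : X → ℝ} {c : ℝ} (h : ∀ x, c ≤ g x) : c ≤ expect p g :=
  (expect_const p c).symm.trans_le (expect_mono p h)

theorem abs_expect_le (p : PMF X) {g : X → ℝ} {c : ℝ} (h : ∀ x, |g x| ≤ c) : |expect p g| ≤ c :=
  abs_le.2 ⟨le_expect_of_le p fun x => (abs_le.1 (h x)).1,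
    expect_le_of_le p fun x => (abs_le.1 (h x)).2⟩

theorem expect_pure (x : X) (g : X → ℝ) : expect (PMF.pure x) g = g x := by
  classical
  rw [expect, Finset.sum_eq_single x] <;> simp +contextual [PMF.pure_apply]

theorem expect_bind (p : PMF X) (q : X → PMF Y) (g : Y → ℝ) :
    expect (p.bind q) g = expect p fun x => expect (q x) g := by
  have h : ∀ y, ((p.bind q) y).toReal = ∑ x, (p x).toReal * (q x y).toReal := by
    intro y
    rw [PMF.bind_apply, tsum_fintype, ENNReal.toReal_sum fun x _ =>
      ENNReal.mul_ne_top (p.apply_ne_top x) ((q x).apply_ne_top y)]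
    simp [ENNReal.toReal_mul]
  simp only [expect, h, Finset.sum_mul, Finset.mul_sum]
  rw [Finset.sum_comm]
  exact Finset.sum_congr rfl fun x _ => Finset.sum_congr rfl fun y _ => by ring

theorem integral_toMeasure_eq_expect [MeasurableSpace X] [MeasurableSingletonClass X]
    (p : PMF X) (g : X → ℝ) : ∫ x, g x ∂p.toMeasure = expect p g := by
  rw [PMF.integral_eq_sum]
  simp [expect]

end Expect

/-! ### Link functions -/

namespace Link

variable (Φ : Link) {R : ℝ}

theorem differentiable : Differentiable ℝ Φ := Φ.contDiff'.differentiable (by norm_num)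

theorem continuous_deriv : Continuous (deriv Φ) := Φ.contDiff'.continuous_deriv (by norm_num)

theorem apply_lt_one (x : ℝ) : Φ x < 1 := by
  have := Φ.symm' x
  have := Φ.pos' (-x)
  linarith

theorem apply_zero : Φ 0 = 1 / 2 := by
  have := Φ.symm' 0
  simp only [neg_zero] at this
  linarith

theorem one_le_kappa_mul_deriv (hR : 0 < R)
    (hΦ : ∀ x ∈ Set.Icc (-(2 * R)) (2 * R), 0 < deriv Φ x) :
    0 < Φ.kappa R ∧ ∀ x ∈ Set.Icc (-(2 * R)) (2 * R), 1 ≤ Φ.kappa R * deriv Φ x := by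
  have hne : (Set.Icc (-(2 * R)) (2 * R)).Nonempty := ⟨0, by constructor <;> linarith⟩
  have hc : IsCompact (deriv Φ '' Set.Icc (-(2 * R)) (2 * R)) :=
    isCompact_Icc.image Φ.continuous_deriv
  obtain ⟨x₀, hx₀, h₀⟩ := hc.sInf_mem (hne.image _)
  have hpos : 0 < sInf (deriv Φ '' Set.Icc (-(2 * R)) (2 * R)) := h₀ ▸ hΦ x₀ hx₀
  refine ⟨inv_pos.2 hpos, fun x hx => ?_⟩
  have hle := csInf_le hc.bddBelow (Set.mem_image_of_mem (deriv Φ) hx)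
  rw [kappa, inv_mul_eq_div, one_le_div hpos]
  exact hle

theorem abs_deriv_div_le_xi {x : ℝ} (hx : x ∈ Set.Icc (-(2 * R)) (2 * R)) :
    |deriv Φ x / Φ x| ≤ Φ.xi R := by
  have hc : IsCompact ((fun x => |deriv Φ x / Φ x|) '' Set.Icc (-(2 * R)) (2 * R)) :=
    isCompact_Icc.image
      (Φ.continuous_deriv.div Φ.differentiable.continuous fun x => (Φ.pos' x).ne').abs
  exact le_csSup hc.bddAbove (Set.mem_image_of_mem _ hx)

theorem abs_sub_le_kappa_mul (hR : 0 < R)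
    (hΦ : ∀ x ∈ Set.Icc (-(2 * R)) (2 * R), 0 < deriv Φ x) {x y : ℝ}
    (hx : x ∈ Set.Icc (-(2 * R)) (2 * R)) (hy : y ∈ Set.Icc (-(2 * R)) (2 * R)) :
    |x - y| ≤ Φ.kappa R * |Φ x - Φ y| := by
  obtain ⟨hκ, hd⟩ := Φ.one_le_kappa_mul_deriv hR hΦ
  have key : ∀ x ∈ Set.Icc (-(2 * R)) (2 * R), ∀ y ∈ Set.Icc (-(2 * R)) (2 * R), x ≤ y →
      y - x ≤ Φ.kappa R * (Φ y - Φ x) := by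
    intro x hx y hy hxy
    have := Convex.mul_sub_le_image_sub_of_le_deriv (f := Φ) (C := (Φ.kappa R)⁻¹)
      (convex_Icc (-(2 * R)) (2 * R)) Φ.differentiable.continuous.continuousOn
      Φ.differentiable.differentiableOn
      (fun z hz => by
        rw [inv_le_iff_one_le_mul₀' hκ]
        exact hd z (interior_subset hz)) x hx y hy hxy
    rwa [inv_mul_le_iff₀ hκ] at this
  rcases le_total x y with h | h
  · rw [abs_sub_comm, abs_of_nonneg (sub_nonneg.2 h), abs_sub_comm (Φ x),
      abs_of_nonneg (sub_nonneg.2 (Φ.monotone' h))]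
    exact key x hx y hy h
  · rw [abs_of_nonneg (sub_nonneg.2 h), abs_of_nonneg (sub_nonneg.2 (Φ.monotone' h))]
    exact key y hy x hx h

theorem abs_log_sub_log_le {x y : ℝ}
    (hx : x ∈ Set.Icc (-(2 * R)) (2 * R)) (hy : y ∈ Set.Icc (-(2 * R)) (2 * R)) :
    |Real.log (Φ x) - Real.log (Φ y)| ≤ Φ.xi R * |x - y| := by
  have := Convex.norm_image_sub_le_of_norm_hasDerivWithin_le
    (f := fun x => Real.log (Φ x)) (f' := fun x => deriv Φ x / Φ x) (C := Φ.xi R)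
    (s := Set.Icc (-(2 * R)) (2 * R))
    (fun z _ => (((Φ.differentiable z).hasDerivAt).log (Φ.pos' z).ne').hasDerivWithinAt)
    (fun z hz => Φ.abs_deriv_div_le_xi hz) (convex_Icc _ _) hy hx
  simpa using this

theorem xi_nonneg (hR : 0 < R) : 0 ≤ Φ.xi R :=
  (abs_nonneg _).trans (Φ.abs_deriv_div_le_xi (x := 0) ⟨by linarith, by linarith⟩)

/-- Compare both extremal quantities at `0`, where `Φ = 1/2`. This lets bare factors `1` be absorbed
into `ξ κ` when the errors are expressed through one statistical scale. -/
theorem one_le_xi_mul_kappa (hR : 0 < R)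
    (hΦ : ∀ x ∈ Set.Icc (-(2 * R)) (2 * R), 0 < deriv Φ x) : 1 ≤ Φ.xi R * Φ.kappa R := by
  have h0 : (0 : ℝ) ∈ Set.Icc (-(2 * R)) (2 * R) := ⟨by linarith, by linarith⟩
  obtain ⟨hκ, hd⟩ := Φ.one_le_kappa_mul_deriv hR hΦ
  have h1 := Φ.abs_deriv_div_le_xi h0
  rw [Φ.apply_zero] at h1
  have h2 := (le_abs_self _).trans h1
  have h3 := hΦ 0 h0
  nlinarith [hd 0 h0]

/-- `Φ` gains less than `1/2` on `[0, 2R]` while its slope there is at least `κ⁻¹`. This makes the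
trivial regret bound `2R` affordable when the statistical error is large. -/
theorem four_mul_le_kappa (hR : 0 < R)
    (hΦ : ∀ x ∈ Set.Icc (-(2 * R)) (2 * R), 0 < deriv Φ x) : 4 * R ≤ Φ.kappa R := by
  have hκ := (Φ.one_le_kappa_mul_deriv hR hΦ).1
  have := Φ.abs_sub_le_kappa_mul hR hΦ (x := 2 * R) (y := 0) ⟨by linarith, by linarith⟩
    ⟨by linarith, by linarith⟩
  rw [Φ.apply_zero, sub_zero, abs_of_pos (by linarith)] at this
  have h1 := Φ.apply_lt_one (2 * R)
  have h2 := Φ.monotone' (show (0 : ℝ) ≤ 2 * R by linarith)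
  rw [Φ.apply_zero] at h2
  rw [abs_of_nonneg (by linarith)] at this
  nlinarith

theorem neg_log_le (hR : 0 < R) {x : ℝ} (hx : x ∈ Set.Icc (-(2 * R)) (2 * R)) :
    -Real.log (Φ x) ≤ 1 + 2 * R * Φ.xi R := by
  have h := Φ.abs_log_sub_log_le (R := R) (x := x) (y := 0) hx ⟨by linarith, by linarith⟩
  rw [Φ.apply_zero, sub_zero, one_div, Real.log_inv] at h
  have h1 : |x| ≤ 2 * R := abs_le.2 hx
  have h2 := mul_le_mul_of_nonneg_left h1 (Φ.xi_nonneg hR)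
  have h3 := Real.log_two_lt_d9
  have := (abs_le.1 h).1
  linarith

end Link

/-! ### Preference probabilities -/

section PrefProb

variable {T : Type*} (Φ : Link) {R : ℝ}

theorem prefProb_zero (r : T → ℝ) (τ₀ τ₁ : T) : prefProb Φ r 0 τ₀ τ₁ = Φ (r τ₀ - r τ₁) := by
  simp [prefProb]

theorem prefProb_one (r : T → ℝ) (τ₀ τ₁ : T) : prefProb Φ r 1 τ₀ τ₁ = 1 - Φ (r τ₀ - r τ₁) := by
  simp [prefProb]

/-- The symmetry of `Φ` reduces outcome `1` to outcome `0` with the trajectories exchanged, so every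
estimate for `log Φ` serves both outcomes. -/
theorem prefProb_one' (r : T → ℝ) (τ₀ τ₁ : T) : prefProb Φ r 1 τ₀ τ₁ = Φ (r τ₁ - r τ₀) := by
  have := Φ.symm' (r τ₀ - r τ₁)
  rw [prefProb_one, ← neg_sub (r τ₀)]
  linarith

theorem prefProb_pos (r : T → ℝ) (o : Fin 2) (τ₀ τ₁ : T) : 0 < prefProb Φ r o τ₀ τ₁ := by
  fin_cases o
  · simpa only [Fin.zero_eta, prefProb_zero] using Φ.pos' _
  · simpa only [Fin.mk_one, prefProb_one'] using Φ.pos' _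

theorem prefProb_le_one (r : T → ℝ) (o : Fin 2) (τ₀ τ₁ : T) : prefProb Φ r o τ₀ τ₁ ≤ 1 := by
  fin_cases o
  · simpa only [Fin.zero_eta, prefProb_zero] using (Φ.apply_lt_one _).le
  · simpa only [Fin.mk_one, prefProb_one'] using (Φ.apply_lt_one _).le

theorem sub_mem_Icc {r : T → ℝ} (hr : ∀ τ, |r τ| ≤ R) (τ₀ τ₁ : T) :
    r τ₀ - r τ₁ ∈ Set.Icc (-(2 * R)) (2 * R) := by
  have h0 := abs_le.1 (hr τ₀)
  have h1 := abs_le.1 (hr τ₁)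
  constructor <;> linarith

theorem log_prefProb_nonpos (r : T → ℝ) (o : Fin 2) (τ₀ τ₁ : T) :
    Real.log (prefProb Φ r o τ₀ τ₁) ≤ 0 :=
  Real.log_nonpos (prefProb_pos Φ r o τ₀ τ₁).le (prefProb_le_one Φ r o τ₀ τ₁)

theorem neg_log_prefProb_le (hR : 0 < R) {r : T → ℝ} (hr : ∀ τ, |r τ| ≤ R) (o : Fin 2)
    (τ₀ τ₁ : T) : -Real.log (prefProb Φ r o τ₀ τ₁) ≤ 1 + 2 * R * Φ.xi R := by
  fin_cases o
  · simpa only [Fin.zero_eta, prefProb_zero] using Φ.neg_log_le hR (sub_mem_Icc hr τ₀ τ₁)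
  · simpa only [Fin.mk_one, prefProb_one'] using Φ.neg_log_le hR (sub_mem_Icc hr τ₁ τ₀)

theorem abs_log_prefProb_le (hR : 0 < R) {r : T → ℝ} (hr : ∀ τ, |r τ| ≤ R) (o : Fin 2)
    (τ₀ τ₁ : T) : |Real.log (prefProb Φ r o τ₀ τ₁)| ≤ 1 + 2 * R * Φ.xi R := by
  rw [abs_of_nonpos (log_prefProb_nonpos Φ r o τ₀ τ₁)]
  exact neg_log_prefProb_le Φ hR hr o τ₀ τ₁

theorem abs_log_prefProb_sub_le {r r' : T → ℝ} (hr : ∀ τ, |r τ| ≤ R) (hr' : ∀ τ, |r' τ| ≤ R)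
    (o : Fin 2) (τ₀ τ₁ : T) :
    |Real.log (prefProb Φ r o τ₀ τ₁) - Real.log (prefProb Φ r' o τ₀ τ₁)| ≤
      Φ.xi R * |(r τ₀ - r τ₁) - (r' τ₀ - r' τ₁)| := by
  fin_cases o
  · simpa only [Fin.zero_eta, prefProb_zero] using
      Φ.abs_log_sub_log_le (sub_mem_Icc hr τ₀ τ₁) (sub_mem_Icc hr' τ₀ τ₁)
  · have h := Φ.abs_log_sub_log_le (sub_mem_Icc hr τ₁ τ₀) (sub_mem_Icc hr' τ₁ τ₀)
    have e : (r τ₁ - r τ₀) - (r' τ₁ - r' τ₀) = -((r τ₀ - r τ₁) - (r' τ₀ - r' τ₁)) := by ring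
    rw [e, abs_neg] at h
    simpa only [Fin.mk_one, prefProb_one'] using h

theorem abs_log_sub_log_le_of_exp_le {p q M : ℝ} (hp : Real.exp (-M) ≤ p)
    (hq : Real.exp (-M) ≤ q) : |Real.log p - Real.log q| ≤ Real.exp M * |p - q| := by
  have key : ∀ p q : ℝ, Real.exp (-M) ≤ p → Real.exp (-M) ≤ q →
      Real.log p - Real.log q ≤ Real.exp M * |p - q| := by
    intro p q hp hq
    have hp0 := (Real.exp_pos _).trans_le hp
    have hq0 := (Real.exp_pos _).trans_le hq
    rw [← Real.log_div hp0.ne' hq0.ne']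
    refine (Real.log_le_sub_one_of_pos (div_pos hp0 hq0)).trans ?_
    have e : p / q - 1 = q⁻¹ * (p - q) := by field_simp
    rw [e]
    have h1 : q⁻¹ ≤ Real.exp M := by
      rw [← inv_inv (Real.exp M), ← Real.exp_neg]
      exact inv_anti₀ (Real.exp_pos _) hq
    exact (mul_le_mul_of_nonneg_left (le_abs_self _) (inv_pos.2 hq0).le).trans
      (mul_le_mul_of_nonneg_right h1 (abs_nonneg _))
  rw [abs_le']
  refine ⟨key p q hp hq, ?_⟩
  have := key q p hq hp
  rw [abs_sub_comm] at this
  linarith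

theorem exp_neg_le_prefProb (hR : 0 < R) {r : T → ℝ} (hr : ∀ τ, |r τ| ≤ R) {M : ℝ}
    (hM : 1 + 2 * R * Φ.xi R ≤ M) (o : Fin 2) (τ₀ τ₁ : T) :
    Real.exp (-M) ≤ prefProb Φ r o τ₀ τ₁ := by
  rw [← Real.le_log_iff_exp_le (prefProb_pos Φ r o τ₀ τ₁)]
  linarith [neg_log_prefProb_le Φ hR hr o τ₀ τ₁]

theorem toReal_outcome (r : T → ℝ) (o : Fin 2) (τ₀ τ₁ : T) :
    (outcome Φ r τ₀ τ₁ o).toReal = prefProb Φ r o τ₀ τ₁ := by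
  rw [outcome, PMF.ofFintype_apply, ENNReal.toReal_ofReal (prefProb_pos Φ r o τ₀ τ₁).le]

/-- The Hellinger affinity of two Bernoulli laws. -/
theorem sqrt_mul_add_sqrt_mul_le {p q : ℝ} (hp : 0 ≤ p) (hp1 : p ≤ 1) (hq : 0 ≤ q) (hq1 : q ≤ 1) :
    √(p * q) + √((1 - p) * (1 - q)) ≤ 1 - (p - q) ^ 2 / 4 := by
  -- The AM–GM defect is `(√p - √q)² / 2`, at least `(p - q)² / 8` because `√p + √q ≤ 2`; the proof
  -- checks the squared form. The two outcomes together give the factor `1/4`.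
  have key : ∀ p q : ℝ, 0 ≤ p → p ≤ 1 → 0 ≤ q → q ≤ 1 →
      √(p * q) ≤ (p + q) / 2 - (p - q) ^ 2 / 8 := by
    intro p q hp hp1 hq hq1
    refine Real.sqrt_le_iff.2 ⟨by nlinarith, ?_⟩
    nlinarith [mul_nonneg (sq_nonneg (p - q)) (show 0 ≤ 2 - p - q by linarith),
      sq_nonneg ((p - q) ^ 2)]
  have h1 := key p q hp hp1 hq hq1
  have h2 := key (1 - p) (1 - q) (by linarith) (by linarith) (by linarith) (by linarith)
  nlinarith

/-- Tilting by half the log-likelihood ratio turns `p` into `√(p q)`, so the sum is a Hellinger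
affinity. -/
theorem sum_prefProb_mul_exp_le (r r' : T → ℝ) (τ₀ τ₁ : T) :
    ∑ o, prefProb Φ r o τ₀ τ₁ * Real.exp ((1 / 2) * (Real.log (prefProb Φ r' o τ₀ τ₁)
      - Real.log (prefProb Φ r o τ₀ τ₁))) ≤
      1 - (Φ (r τ₀ - r τ₁) - Φ (r' τ₀ - r' τ₁)) ^ 2 / 4 := by
  have h : ∀ p q : ℝ, 0 < p → 0 < q →
      p * Real.exp ((1 / 2) * (Real.log q - Real.log p)) = √(p * q) := by
    intro p q hp hq
    rw [Real.sqrt_eq_rpow, Real.rpow_def_of_pos (mul_pos hp hq), Real.log_mul hp.ne' hq.ne']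
    nth_rewrite 1 [← Real.exp_log hp]
    rw [← Real.exp_add]
    ring_nf
  simp only [h _ _ (prefProb_pos Φ r _ τ₀ τ₁) (prefProb_pos Φ r' _ τ₀ τ₁)]
  rw [Fin.sum_univ_two, prefProb_zero, prefProb_zero, prefProb_one, prefProb_one]
  exact sqrt_mul_add_sqrt_mul_le (Φ.pos' _).le (Φ.apply_lt_one _).le (Φ.pos' _).le
    (Φ.apply_lt_one _).le

/-- By `1 + u ≤ exp u`, the affinity is at least one minus half the Kullback–Leibler divergence;
compare with its upper bound. -/
theorem sq_div_two_le_sum_prefProb_mul (r r' : T → ℝ) (τ₀ τ₁ : T) :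
    (Φ (r τ₀ - r τ₁) - Φ (r' τ₀ - r' τ₁)) ^ 2 / 2 ≤
      ∑ o, prefProb Φ r o τ₀ τ₁ * (Real.log (prefProb Φ r o τ₀ τ₁)
      - Real.log (prefProb Φ r' o τ₀ τ₁)) := by
  have h := sum_prefProb_mul_exp_le Φ r r' τ₀ τ₁
  have h1 : prefProb Φ r 0 τ₀ τ₁ + prefProb Φ r 1 τ₀ τ₁ = 1 := by
    rw [prefProb_zero, prefProb_one]; ring
  rw [Fin.sum_univ_two] at h ⊢
  have e : ∀ o, prefProb Φ r o τ₀ τ₁ * ((1 / 2) * (Real.log (prefProb Φ r' o τ₀ τ₁)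
      - Real.log (prefProb Φ r o τ₀ τ₁)) + 1) ≤ prefProb Φ r o τ₀ τ₁ *
      Real.exp ((1 / 2) * (Real.log (prefProb Φ r' o τ₀ τ₁)
      - Real.log (prefProb Φ r o τ₀ τ₁))) := fun o =>
    mul_le_mul_of_nonneg_left (Real.add_one_le_exp _) (prefProb_pos Φ r o τ₀ τ₁).le
  have e0 := e 0
  have e1 := e 1
  nlinarith

end PrefProb

/-! ### Bracketing numbers -/

section Bracketing

variable {ι T : Type*} [Fintype ι] [Fintype T] (Φ : Link) (G : Set (ι → T → ℝ)) {ε : ℝ}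

/-- On a finite set the preference probabilities lie in a finite dimensional cube, so that finitely
many brackets suffice. -/
theorem exists_brackets (hε : 0 < ε) : {n : ℕ | ∃ g₁ g₂ : Fin n → T → T → ι → Fin 2 → ℝ,
    (∀ b τ₀ τ₁, (∀ i o, g₁ b τ₀ τ₁ i o ≤ g₂ b τ₀ τ₁ i o) ∧
      ∑ i, ∑ o, |g₁ b τ₀ τ₁ i o - g₂ b τ₀ τ₁ i o| ≤ ε) ∧
    ∀ r ∈ G, ∃ b, ∀ τ₀ τ₁ i o,
      g₁ b τ₀ τ₁ i o ≤ prefProb Φ (r i) o τ₀ τ₁ ∧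
        prefProb Φ (r i) o τ₀ τ₁ ≤ g₂ b τ₀ τ₁ i o}.Nonempty := by
  have hc : IsCompact (Set.Icc (0 : T → T → ι → Fin 2 → ℝ) 1) := isCompact_Icc
  -- There are `2 * card ι` coordinates, each with a bracket of width `2η`; the `+ 1` keeps `η`
  -- defined for empty `ι`.
  set η : ℝ := ε / (4 * (Fintype.card ι + 1)) with hη
  have hη0 : 0 < η := by positivity
  obtain ⟨t, htf, ht⟩ := Metric.totallyBounded_iff.1 hc.totallyBounded η hη0
  have := htf.fintype
  let e := (Fintype.equivFin t).symm
  refine ⟨Fintype.card t, fun b τ₀ τ₁ i o => (e b : T → T → ι → Fin 2 → ℝ) τ₀ τ₁ i o - η,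
    fun b τ₀ τ₁ i o => (e b : T → T → ι → Fin 2 → ℝ) τ₀ τ₁ i o + η, fun b τ₀ τ₁ =>
    ⟨fun i o => by linarith, ?_⟩, fun r _ => ?_⟩
  · have h : ∀ x : ℝ, |x - η - (x + η)| = 2 * η := fun x => by
      rw [show x - η - (x + η) = -(2 * η) by ring, abs_neg, abs_of_pos (by positivity)]
    simp only [h, Finset.sum_const, Finset.card_univ, Fintype.card_fin, nsmul_eq_mul]
    rw [hη]
    push_cast
    have : (Fintype.card ι : ℝ) * (2 * (2 * (ε / (4 * (Fintype.card ι + 1))))) =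
        ε * (Fintype.card ι / (Fintype.card ι + 1)) := by field_simp; ring
    rw [this]
    exact mul_le_of_le_one_right hε.le ((div_le_one (by positivity)).2 (by linarith))
  · have hm : (fun τ₀ τ₁ i o => prefProb Φ (r i) o τ₀ τ₁) ∈
        Set.Icc (0 : T → T → ι → Fin 2 → ℝ) 1 :=
      ⟨fun τ₀ τ₁ i o => (prefProb_pos Φ (r i) o τ₀ τ₁).le,
        fun τ₀ τ₁ i o => prefProb_le_one Φ (r i) o τ₀ τ₁⟩
    obtain ⟨c, hct, hcd⟩ := Set.mem_iUnion₂.1 (ht hm)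
    refine ⟨e.symm ⟨c, hct⟩, fun τ₀ τ₁ i o => ?_⟩
    have hd : dist (prefProb Φ (r i) o τ₀ τ₁) (c τ₀ τ₁ i o) ≤ η :=
      ((dist_le_pi_dist (fun o => prefProb Φ (r i) o τ₀ τ₁) (c τ₀ τ₁ i) o).trans
      ((dist_le_pi_dist (fun i o => prefProb Φ (r i) o τ₀ τ₁) (c τ₀ τ₁) i).trans
      ((dist_le_pi_dist (fun τ₁ i o => prefProb Φ (r i) o τ₀ τ₁) (c τ₀) τ₁).trans
      ((dist_le_pi_dist (fun τ₀ τ₁ i o => prefProb Φ (r i) o τ₀ τ₁) c τ₀).trans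
        (Metric.mem_ball.1 hcd).le))))
    rw [Real.dist_eq] at hd
    have := abs_le.1 hd
    simp only [Equiv.apply_symm_apply]
    constructor <;> linarith

/-- A nonempty class has a net of its own members, in the supremum distance of the preference
probabilities, whose size is the bracketing number. -/
theorem exists_net (hε : 0 < ε) (hG : G.Nonempty) :
    ∃ c : Fin (bracketingNumber Φ G ε) → ι → T → ℝ, (∀ b, c b ∈ G) ∧
      ∀ r ∈ G, ∃ b, ∀ i o τ₀ τ₁,
        |prefProb Φ (r i) o τ₀ τ₁ - prefProb Φ (c b i) o τ₀ τ₁| ≤ ε := by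
  obtain ⟨g₁, g₂, hg, hr⟩ := Nat.sInf_mem (exists_brackets Φ G hε)
  classical
  obtain ⟨r₀, hr₀⟩ := hG
  let In : Fin (bracketingNumber Φ G ε) → (ι → T → ℝ) → Prop := fun b r => ∀ τ₀ τ₁ i o,
    g₁ b τ₀ τ₁ i o ≤ prefProb Φ (r i) o τ₀ τ₁ ∧ prefProb Φ (r i) o τ₀ τ₁ ≤ g₂ b τ₀ τ₁ i o
  -- Each bracket is represented by a member of the class inside it; brackets that miss the class
  -- get the default `r₀`.
  have hex : ∀ b, ∃ c ∈ G, ∀ r ∈ G, In b r → In b c := by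
    intro b
    by_cases h : ∃ r ∈ G, In b r
    · obtain ⟨r, hrG, hr⟩ := h
      exact ⟨r, hrG, fun _ _ _ => hr⟩
    · exact ⟨r₀, hr₀, fun r hr h' => absurd ⟨r, hr, h'⟩ h⟩
  choose c hcG hc using hex
  refine ⟨c, hcG, fun r hrG => ?_⟩
  obtain ⟨b, hb⟩ := hr r hrG
  refine ⟨b, fun i o τ₀ τ₁ => ?_⟩
  have h1 := hb τ₀ τ₁ i o
  have h2 := hc b r hrG hb τ₀ τ₁ i o
  have hw : |g₁ b τ₀ τ₁ i o - g₂ b τ₀ τ₁ i o| ≤ ε :=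
    ((Finset.single_le_sum (f := fun o => |g₁ b τ₀ τ₁ i o - g₂ b τ₀ τ₁ i o|)
      (fun _ _ => abs_nonneg _) (Finset.mem_univ o)).trans
      (Finset.single_le_sum (f := fun i => ∑ o, |g₁ b τ₀ τ₁ i o - g₂ b τ₀ τ₁ i o|)
        (fun _ _ => Finset.sum_nonneg fun _ _ => abs_nonneg _) (Finset.mem_univ i))).trans
      (hg b τ₀ τ₁).2
  have := abs_le.1 hw
  exact abs_le.2 ⟨by linarith, by linarith⟩

theorem bracketingNumber_pos (hε : 0 < ε) (hG : G.Nonempty) : 0 < bracketingNumber Φ G ε := by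
  obtain ⟨c, -, hr⟩ := exists_net Φ G hε hG
  obtain ⟨r, hrG⟩ := hG
  obtain ⟨b, -⟩ := hr r hrG
  exact b.pos

end Bracketing

/-! ### Concentration for independent samples -/

section Concentration

open MeasureTheory

variable {Z : Type*} [Fintype Z] [MeasurableSpace Z] [MeasurableSingletonClass Z]

/-- Hoeffding's lemma on `[-M, M]`, with the mean moved to the right-hand side. -/
theorem expect_exp_le_of_abs_le (p : PMF Z) {X : Z → ℝ} {M : ℝ} (hX : ∀ z, |X z| ≤ M) (t : ℝ) :
    expect p (fun z => Real.exp (t * X z)) ≤ Real.exp (t * expect p X + M ^ 2 * t ^ 2 / 2) := by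
  have h := (ProbabilityTheory.hasSubgaussianMGF_of_mem_Icc (μ := p.toMeasure) (X := X)
    (a := -M) (b := M) (Measurable.of_discrete.aemeasurable)
    (Filter.Eventually.of_forall fun z => abs_le.1 (hX z))).mgf_le t
  rw [integral_toMeasure_eq_expect, ProbabilityTheory.mgf, integral_toMeasure_eq_expect] at h
  have e : (((‖M - -M‖₊ / 2) ^ 2 : NNReal) : ℝ) = M ^ 2 := by
    push_cast
    rw [Real.norm_eq_abs, div_pow, sq_abs]
    ring
  rw [e] at h
  rw [Real.exp_add]
  refine le_trans (le_of_eq ?_) (mul_le_mul_of_nonneg_left h (Real.exp_pos _).le)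
  rw [← expect_const_mul]
  congr 1
  funext z
  rw [← Real.exp_add]
  ring_nf

/-- Chernoff's bound for sums of independent variables, uniformly over a finite family. -/
theorem ofReal_one_sub_le_pi {ι : Type*} [Fintype ι] {N n : ℕ} (p : Fin N → PMF Z)
    (F : ι → Fin N → Z → ℝ) (a : ι → Fin N → ℝ)
    (hF : ∀ b i, expect (p i) (fun z => Real.exp (F b i z)) ≤ Real.exp (a b i))
    {δ : ℝ} (hδ : 0 < δ) :
    ENNReal.ofReal (1 - δ) ≤
      (Measure.pi fun i => Measure.pi fun _ : Fin n => (p i).toMeasure)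
        {D | ∀ b, ∑ i, ∑ j, F b i (D i j) ≤ n * ∑ i, a b i +
          Real.log (Fintype.card ι / δ)} := by
  set μ : Measure (Fin N → Fin n → Z) :=
    Measure.pi fun i => Measure.pi fun _ : Fin n => (p i).toMeasure
  have hmgf : ∀ b, ∫ D, Real.exp (∑ i, ∑ j, F b i (D i j)) ∂μ ≤ Real.exp (n * ∑ i, a b i) := by
    intro b
    simp only [Real.exp_sum]
    rw [integral_fintype_prod_eq_prod
      (f := fun i (x : Fin n → Z) => ∏ j, Real.exp (F b i (x j)))]
    rw [Finset.mul_sum, Real.exp_sum]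
    refine Finset.prod_le_prod (fun i _ => integral_nonneg fun x =>
      Finset.prod_nonneg fun j _ => (Real.exp_pos _).le) fun i _ => ?_
    rw [integral_fintype_prod_eq_prod (f := fun _ z => Real.exp (F b i z))]
    rw [Finset.prod_const, Finset.card_univ, Fintype.card_fin, Real.exp_nat_mul,
      integral_toMeasure_eq_expect]
    exact pow_le_pow_left₀ (expect_nonneg _ fun z => (Real.exp_pos _).le) (hF b i) n
  set S : Set (Fin N → Fin n → Z) := {D | ∀ b, ∑ i, ∑ j, F b i (D i j) ≤ n * ∑ i, a b i +
          Real.log (Fintype.card ι / δ)}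
  have hbad : μ.real Sᶜ ≤ δ := by
    have hsub : Sᶜ ⊆ ⋃ b ∈ (Finset.univ : Finset ι), {D | n * ∑ i, a b i +
          Real.log (Fintype.card ι / δ) ≤ ∑ i, ∑ j, F b i (D i j)} := by
      intro D hD
      simp only [S, Set.mem_compl_iff, Set.mem_ofPred_eq, not_forall, not_le] at hD
      obtain ⟨b, hb⟩ := hD
      exact Set.mem_iUnion₂.2 ⟨b, Finset.mem_univ b, hb.le⟩
    refine (measureReal_mono hsub (measure_ne_top _ _)).trans
      ((measureReal_biUnion_finset_le _ _).trans ?_)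
    rcases isEmpty_or_nonempty ι with hι | hι
    · simpa using hδ.le
    have hcard : (0 : ℝ) < Fintype.card ι := by exact_mod_cast Fintype.card_pos
    have hb : ∀ b ∈ (Finset.univ : Finset ι), μ.real {D | n * ∑ i, a b i +
          Real.log (Fintype.card ι / δ) ≤ ∑ i, ∑ j, F b i (D i j)} ≤ δ / Fintype.card ι := by
      intro b _
      -- The Chernoff parameter is `1`: tilts are built into `F`, so differently scaled families can
      -- share one union bound.
      refine (ProbabilityTheory.measure_ge_le_exp_mul_mgf (μ := μ) (t := 1) _ zero_le_one
        Integrable.of_finite).trans ?_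
      simp only [ProbabilityTheory.mgf, one_mul]
      refine (mul_le_mul_of_nonneg_left (hmgf b) (Real.exp_pos _).le).trans (le_of_eq ?_)
      rw [← Real.exp_add]
      have : -1 * (n * ∑ i, a b i + Real.log (Fintype.card ι / δ)) + n * ∑ i, a b i =
          -Real.log (Fintype.card ι / δ) := by ring
      rw [this, ← Real.log_inv, Real.exp_log (by positivity), inv_div]
    refine (Finset.sum_le_sum hb).trans (le_of_eq ?_)
    rw [Finset.sum_const, Finset.card_univ, nsmul_eq_mul]
    field_simp
  have hS : μ.real S + μ.real Sᶜ = 1 := by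
    rw [measureReal_add_measureReal_compl (Set.toFinite S).measurableSet, probReal_univ]
  rw [← ENNReal.ofReal_toReal (measure_ne_top μ S)]
  exact ENNReal.ofReal_le_ofReal (by rw [← measureReal_def]; linarith)

end Concentration

instance {S A : Type*} {H : ℕ} : MeasurableSingletonClass (Traj S A H) :=
  ⟨fun _ => MeasurableSpace.measurableSet_top⟩

theorem card_mul_expect_uniformOfFinset {X : Type*} [Fintype X] {s : Finset X} (hs : s.Nonempty)
    (g : X → ℝ) : (s.card : ℝ) * expect (PMF.uniformOfFinset s hs) g = ∑ x ∈ s, g x := by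
  classical
  have hc : (s.card : ℝ) ≠ 0 := by
    rw [Nat.cast_ne_zero, Finset.card_ne_zero]
    exact hs
  rw [expect, Finset.mul_sum, ← Finset.sum_subset (Finset.subset_univ s)]
  · refine Finset.sum_congr rfl fun x hx => ?_
    rw [PMF.uniformOfFinset_apply_of_mem hs hx, ENNReal.toReal_inv, ENNReal.toReal_natCast]
    field_simp
  · intro x _ hx
    rw [PMF.uniformOfFinset_apply_of_notMem hs hx]
    simp

namespace MDP

variable {S A : Type*} {H : ℕ} [Fintype S] [Fintype A]

theorem J_sub_J_le (P : MDP S A H) (π π' : Policy S A H) {r : Traj S A H → ℝ} {c : ℝ}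
    (h : ∀ τ₀ τ₁, r τ₀ - r τ₁ ≤ c) : P.J π r - P.J π' r ≤ c := by
  have h1 : ∀ τ₁, P.J π r - r τ₁ ≤ c := fun τ₁ => by
    rw [J, ← expect_const (P.occupancy π) (r τ₁), ← expect_sub]
    exact expect_le_of_le _ fun τ₀ => by simpa [expect_const] using h τ₀ τ₁
  have h2 := expect_le_of_le (P.occupancy π') h1
  rw [expect_sub, expect_const] at h2
  exact h2

end MDP

namespace Model

variable {S A Ω : Type*} {H N d k : ℕ} (M : Model S A Ω H N d k) {R B : ℝ}

/-! ### The model: reward classes and distances -/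

theorem reward_sub_reward (ω : Ω) (θ : EuclideanSpace ℝ (Fin k)) (τ₀ τ₁ : Traj S A H) :
    M.reward ω θ τ₀ - M.reward ω θ τ₁ = inner ℝ (M.repDiff ω τ₀ τ₁) θ := by
  rw [reward, reward, repDiff, inner_sub_left]

theorem mem_rewardClass (ω : Ω) {θ : Fin N → EuclideanSpace ℝ (Fin k)} (hθ : ∀ i, ‖θ i‖ ≤ B) :
    (fun i => M.reward ω (θ i)) ∈ M.rewardClass B :=
  ⟨ω, θ, hθ, rfl⟩

theorem abs_reward_le (hN : 0 < N) (hbd : ∀ r ∈ M.rewardClass B, ∀ i τ, |r i τ| ≤ R) (ω : Ω)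
    {θ : EuclideanSpace ℝ (Fin k)} (hθ : ‖θ‖ ≤ B) (τ : Traj S A H) : |M.reward ω θ τ| ≤ R :=
  hbd _ (M.mem_rewardClass ω (θ := fun _ => θ) fun _ => hθ) ⟨0, hN⟩ τ

/-- An isometry preserves inner products, so rotating the parameter along with the representation
leaves the reward differences unchanged; only the error `η` remains, paired with `θ`. -/
theorem abs_reward_sub_le_of_close {ω ω' : Ω}
    {P : EuclideanSpace ℝ (Fin k) ≃ₗᵢ[ℝ] EuclideanSpace ℝ (Fin k)} {η : ℝ} (hη : 0 ≤ η)
    (h : ∀ τ₀ τ₁, ‖M.repDiff ω τ₀ τ₁ - P (M.repDiff ω' τ₀ τ₁)‖ ≤ η)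
    {θ : EuclideanSpace ℝ (Fin k)} (hθ : ‖θ‖ ≤ B) (τ₀ τ₁ : Traj S A H) :
    |(M.reward ω' θ τ₀ - M.reward ω' θ τ₁) - (M.reward ω (P θ) τ₀ - M.reward ω (P θ) τ₁)| ≤
      B * η := by
  rw [reward_sub_reward, reward_sub_reward, ← P.inner_map_map (M.repDiff ω' τ₀ τ₁) θ,
    ← inner_sub_left, mul_comm]
  refine (abs_real_inner_le_norm _ _).trans ?_
  rw [norm_sub_rev, P.norm_map]
  exact mul_le_mul (h τ₀ τ₁) hθ (norm_nonneg _) hη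

variable [Fintype S] [Fintype A]

theorem expect_userLaw (i : Fin N) (g : Fin 2 × Traj S A H × Traj S A H → ℝ) :
    expect (M.userLaw i) g = expect M.μ₀ fun τ₀ => expect M.μ₁ fun τ₁ =>
      ∑ o, prefProb M.Φ (M.rstar i) o τ₀ τ₁ * g (o, τ₀, τ₁) := by
  simp only [userLaw, expect_bind, expect_pure]
  congr 1
  funext τ₀
  congr 1
  funext τ₁
  simp only [expect, toReal_outcome]

/-- Expected log-likelihood of one sample of user `i` under the reward `r`. -/
noncomputable def meanLogLik (i : Fin N) (r : Traj S A H → ℝ) : ℝ :=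
  expect (M.userLaw i) fun z => Real.log (prefProb M.Φ r z.1 z.2.1 z.2.2)

/-- Mean squared distance of the preference probabilities of two rewards. -/
noncomputable def probDist (r r' : Traj S A H → ℝ) : ℝ :=
  expect M.μ₀ fun τ₀ => expect M.μ₁ fun τ₁ =>
    (M.Φ (r τ₀ - r τ₁) - M.Φ (r' τ₀ - r' τ₁)) ^ 2

/-- Mean squared distance of the reward differences of two rewards. -/
noncomputable def rewardDist (r r' : Traj S A H → ℝ) : ℝ :=
  expect M.μ₀ fun τ₀ => expect M.μ₁ fun τ₁ => ((r τ₀ - r τ₁) - (r' τ₀ - r' τ₁)) ^ 2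

theorem rewardDist_nonneg (r r' : Traj S A H → ℝ) : 0 ≤ M.rewardDist r r' :=
  expect_nonneg _ fun _ => expect_nonneg _ fun _ => sq_nonneg _

theorem rewardDist_le_probDist (hR : 0 < R)
    (hΦ : ∀ x ∈ Set.Icc (-(2 * R)) (2 * R), 0 < deriv M.Φ x) {r r' : Traj S A H → ℝ}
    (hr : ∀ τ, |r τ| ≤ R) (hr' : ∀ τ, |r' τ| ≤ R) :
    M.rewardDist r r' ≤ M.Φ.kappa R ^ 2 * M.probDist r r' := by
  rw [probDist, ← expect_const_mul]
  refine expect_mono _ fun τ₀ => ?_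
  rw [← expect_const_mul]
  refine expect_mono _ fun τ₁ => ?_
  have h := M.Φ.abs_sub_le_kappa_mul hR hΦ (sub_mem_Icc hr τ₀ τ₁) (sub_mem_Icc hr' τ₀ τ₁)
  have := pow_le_pow_left₀ (abs_nonneg _) h 2
  rwa [mul_pow, sq_abs, sq_abs] at this

theorem probDist_le_meanLogLik_sub (i : Fin N) (r : Traj S A H → ℝ) :
    M.probDist (M.rstar i) r ≤ 2 * (M.meanLogLik i (M.rstar i) - M.meanLogLik i r) := by
  have h : M.probDist (M.rstar i) r / 2 ≤ M.meanLogLik i (M.rstar i) - M.meanLogLik i r := by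
    rw [meanLogLik, meanLogLik, ← expect_sub, expect_userLaw, probDist, div_eq_inv_mul,
      ← expect_const_mul]
    refine expect_mono _ fun τ₀ => ?_
    rw [← expect_const_mul]
    refine expect_mono _ fun τ₁ => ?_
    rw [← div_eq_inv_mul]
    exact sq_div_two_le_sum_prefProb_mul M.Φ (M.rstar i) r τ₀ τ₁
  linarith

/-- The affinity bound and `1 - x ≤ exp (-x)`. In Chernoff's bound the exponent is then a squared
distance itself, which yields the fast rate for the MLE. -/
theorem expect_exp_half_le (i : Fin N) (r : Traj S A H → ℝ) :
    expect (M.userLaw i) (fun z => Real.exp ((1 / 2) *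
      (Real.log (prefProb M.Φ r z.1 z.2.1 z.2.2)
        - Real.log (prefProb M.Φ (M.rstar i) z.1 z.2.1 z.2.2)))) ≤
      Real.exp (-(M.probDist (M.rstar i) r / 4)) := by
  refine le_trans ?_ (Real.add_one_le_exp _)
  have e : -(M.probDist (M.rstar i) r / 4) + 1 = expect M.μ₀ fun τ₀ => expect M.μ₁ fun τ₁ =>
      1 - (1 / 4) * (M.Φ (M.rstar i τ₀ - M.rstar i τ₁) - M.Φ (r τ₀ - r τ₁)) ^ 2 := by
    simp only [expect_sub, expect_const, expect_const_mul, probDist]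
    ring
  rw [e, expect_userLaw]
  refine expect_mono _ fun τ₀ => expect_mono _ fun τ₁ => ?_
  refine (sum_prefProb_mul_exp_le M.Φ (M.rstar i) r τ₀ τ₁).trans (le_of_eq (by ring))

/-! ### Clusters and label discrepancy -/

theorem card_mul_expect_clusterLaw {K : ℕ} (f : Fin N → Fin K) (i : Fin N)
    (g : Fin 2 × Traj S A H × Traj S A H → ℝ) :
    ((Finset.univ.filter fun j => f j = f i).card : ℝ) * expect (M.clusterLaw f i) g =
      ∑ j with f j = f i, expect (M.userLaw j) g := by
  rw [clusterLaw, expect_bind]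
  exact card_mul_expect_uniformOfFinset (s := Finset.univ.filter fun j => f j = f i)
    ⟨i, by simp⟩ _

/-- Bounded rewards bound the log-likelihoods, so the real supremum is over a bounded set and is a
genuine upper bound. -/
theorem abs_sub_le_labelDisc (hR : 0 < R) {G : Set (Traj S A H → ℝ)}
    (hG : ∀ r ∈ G, ∀ τ, |r τ| ≤ R) (p q : PMF (Fin 2 × Traj S A H × Traj S A H))
    {r : Traj S A H → ℝ} (hr : r ∈ G) :
    |expect p (fun z => Real.log (prefProb M.Φ r z.1 z.2.1 z.2.2))
      - expect q (fun z => Real.log (prefProb M.Φ r z.1 z.2.1 z.2.2))| ≤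
      labelDisc M.Φ p q G := by
  refine le_csSup ⟨(1 + 2 * R * M.Φ.xi R) + (1 + 2 * R * M.Φ.xi R), ?_⟩
    (Set.mem_image_of_mem _ hr)
  rintro _ ⟨r, hr, rfl⟩
  exact (abs_sub _ _).trans (add_le_add
    (abs_expect_le _ fun z => abs_log_prefProb_le M.Φ hR (hG r hr) _ _ _)
    (abs_expect_le _ fun z => abs_log_prefProb_le M.Φ hR (hG r hr) _ _ _))

theorem labelDisc_nonneg {T : Type*} [Fintype T] (Φ : Link) (p q : PMF (Fin 2 × T × T))
    (G : Set (T → ℝ)) : 0 ≤ labelDisc Φ p q G := by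
  apply Real.sSup_nonneg
  rintro _ ⟨r, -, rfl⟩
  exact abs_nonneg _

/-- Every cluster has a member whose true parameter explains the pooled data of the cluster up to
the label discrepancies of its members. -/
theorem exists_representatives (hR : 0 < R) {K : ℕ} (hN : 0 < N)
    (hbd : ∀ r ∈ M.rewardClass B, ∀ i τ, |r i τ| ≤ R) (hθ : ∀ i, ‖M.θstar i‖ ≤ B)
    (f : Fin N → Fin K) :
    ∃ s : Fin K → Fin N,
      ∑ i, M.meanLogLik i (M.rstar i) - ∑ i, M.meanLogLik i (M.rstar (s (f i))) ≤
        ∑ i, labelDisc M.Φ (M.userLaw i) (M.clusterLaw f i) (M.fixedRepClass B M.ωstar) := by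
  set disc : Fin N → ℝ := fun i =>
    labelDisc M.Φ (M.userLaw i) (M.clusterLaw f i) (M.fixedRepClass B M.ωstar)
  have hG : ∀ r ∈ M.fixedRepClass B M.ωstar, ∀ τ, |r τ| ≤ R := by
    rintro _ ⟨θ, hθ, rfl⟩ τ
    exact M.abs_reward_le hN hbd _ hθ τ
  have key : ∀ l, ∃ s : Fin N, ∑ i with f i = l, (M.meanLogLik i (M.rstar i) - disc i) ≤
      ∑ i with f i = l, M.meanLogLik i (M.rstar s) := by
    intro l
    rcases (Finset.univ.filter fun i => f i = l).eq_empty_or_nonempty with he | hne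
    · exact ⟨⟨0, hN⟩, by rw [he]; simp⟩
    -- Averaging over candidates `s` in the cluster: the pooled likelihood of the true reward of `j`
    -- falls short of the likelihood for `j` itself by at most the discrepancy of `j`. Summing over
    -- `j`, some candidate does at least as well as the average.
    have h := Finset.exists_le_of_sum_le (s := Finset.univ.filter fun i => f i = l)
      (f := fun _ => ∑ i with f i = l, (M.meanLogLik i (M.rstar i) - disc i))
      (g := fun s => ∑ i with f i = l, M.meanLogLik i (M.rstar s)) hne ?_
    · obtain ⟨s, -, hs⟩ := h
      exact ⟨s, hs⟩
    rw [Finset.sum_const, nsmul_eq_mul, Finset.mul_sum]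
    refine Finset.sum_le_sum fun j hj => ?_
    obtain rfl : f j = l := (Finset.mem_filter.1 hj).2
    have h1 := M.card_mul_expect_clusterLaw f j
      (fun z => Real.log (prefProb M.Φ (M.rstar j) z.1 z.2.1 z.2.2))
    change _ ≤ ∑ i with f i = f j, expect (M.userLaw i)
      (fun z => Real.log (prefProb M.Φ (M.rstar j) z.1 z.2.1 z.2.2))
    rw [← h1]
    refine mul_le_mul_of_nonneg_left ?_ (Nat.cast_nonneg _)
    have h2 := (abs_le.1 (M.abs_sub_le_labelDisc hR hG (M.userLaw j) (M.clusterLaw f j)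
      (r := M.rstar j) ⟨_, hθ j, rfl⟩)).2
    simp only [meanLogLik, disc]
    linarith
  choose s hs using key
  refine ⟨s, ?_⟩
  have h := Finset.sum_le_sum fun l (_ : l ∈ Finset.univ) => hs l
  have e : ∀ l, ∑ i with f i = l, M.meanLogLik i (M.rstar (s l)) =
      ∑ i with f i = l, M.meanLogLik i (M.rstar (s (f i))) := fun l =>
    Finset.sum_congr rfl fun i hi => by rw [(Finset.mem_filter.1 hi).2]
  simp only [e] at h
  rw [Finset.sum_fiberwise, Finset.sum_fiberwise, Finset.sum_sub_distrib] at h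
  linarith

/-! ### Regret of one user -/

theorem expect_occupancy_sub (π : Policy S A H) (μ : PMF (Traj S A H))
    (r r' : Traj S A H → ℝ) :
    (expect (M.mdp.occupancy π) fun τ₀ => expect μ fun τ₁ => r τ₀ - r τ₁ - r' τ₀ + r' τ₁) =
      (M.mdp.J π r - expect μ r) - (M.mdp.J π r' - expect μ r') := by
  simp only [expect_add, expect_sub, expect_const, MDP.J]
  ring

/-- A finite bound excludes the value `∞` of a positive number over zero, so the ratio can be
cleared even when the distance vanishes. -/
theorem le_of_concentrability_le {C : ℝ} (hC : 0 ≤ C) {π : Policy S A H}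
    {μ : PMF (Traj S A H)} {i : Fin N}
    (h : M.concentrability (M.rewardClass B) π μ i ≤ ENNReal.ofReal C)
    {r : Fin N → Traj S A H → ℝ} (hr : r ∈ M.rewardClass B) :
    (M.mdp.J π (M.rstar i) - expect μ (M.rstar i)) - (M.mdp.J π (r i) - expect μ (r i)) ≤
      C * √(M.rewardDist (M.rstar i) (r i)) := by
  have h1 := (le_iSup₂ (f := fun (r : Fin N → Traj S A H → ℝ) (_ : r ∈ M.rewardClass B) =>
    ENNReal.ofReal (expect (M.mdp.occupancy π) fun τ₀ => expect μ fun τ₁ =>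
      M.rstar i τ₀ - M.rstar i τ₁ - r i τ₀ + r i τ₁) /
    ENNReal.ofReal (√(expect M.μ₀ fun τ₀ => expect M.μ₁ fun τ₁ =>
      |M.rstar i τ₀ - M.rstar i τ₁ - r i τ₀ + r i τ₁| ^ 2))) r hr).trans h
  have e : (expect M.μ₀ fun τ₀ => expect M.μ₁ fun τ₁ =>
      |M.rstar i τ₀ - M.rstar i τ₁ - r i τ₀ + r i τ₁| ^ 2) =
      M.rewardDist (M.rstar i) (r i) := by
    rw [rewardDist]
    congr 1
    funext τ₀
    congr 1
    funext τ₁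
    rw [sq_abs]
    ring
  rw [e, expect_occupancy_sub] at h1
  have h2 : ENNReal.ofReal ((M.mdp.J π (M.rstar i) - expect μ (M.rstar i)) -
      (M.mdp.J π (r i) - expect μ (r i))) ≤
      ENNReal.ofReal C * ENNReal.ofReal (√(M.rewardDist (M.rstar i) (r i))) := by
    rwa [ENNReal.div_le_iff_le_mul (Or.inr ENNReal.ofReal_ne_top)
      (Or.inl ENNReal.ofReal_ne_top)] at h1
  rw [← ENNReal.ofReal_mul hC] at h2
  exact (ENNReal.ofReal_le_ofReal_iff (by positivity)).1 h2

/-- Since the true parameter is in the interior of the ball, concentrability also controls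
overestimation by rewards with the true representation. -/
theorem neg_le_of_concentrability_le {C : ℝ} (hC : 0 ≤ C) {π : Policy S A H}
    {μ : PMF (Traj S A H)} {i : Fin N} (hi : ‖M.θstar i‖ < B)
    (h : M.concentrability (M.rewardClass B) π μ i ≤ ENNReal.ofReal C)
    {θ : EuclideanSpace ℝ (Fin k)} (hθ : ‖θ‖ ≤ B) :
    (M.mdp.J π (M.reward M.ωstar θ) - expect μ (M.reward M.ωstar θ)) -
        (M.mdp.J π (M.rstar i) - expect μ (M.rstar i)) ≤
      C * √(M.rewardDist (M.rstar i) (M.reward M.ωstar θ)) := by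
  have hB : 0 < B := (norm_nonneg _).trans_lt hi
  -- The point `θ'` lies opposite to `θ` as seen from `θstar i`. Since `‖θstar i - θ‖ ≤ 2B`, this
  -- step length keeps it in the ball. Both sides of the inequality scale by `t`, so the constant
  -- does not depend on the distance to the boundary.
  set t : ℝ := (B - ‖M.θstar i‖) / (2 * B)
  have ht : 0 < t := div_pos (by linarith) (by linarith)
  set θ' := M.θstar i + t • (M.θstar i - θ)
  have hθ' : ‖θ'‖ ≤ B := by
    have h1 : ‖M.θstar i - θ‖ ≤ 2 * B := (norm_sub_le _ _).trans (by linarith)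
    have h2 : t * (2 * B) = B - ‖M.θstar i‖ := by
      simp only [t]
      field_simp
    calc ‖θ'‖ ≤ ‖M.θstar i‖ + t * ‖M.θstar i - θ‖ := by
          refine (norm_add_le _ _).trans ?_
          rw [norm_smul, Real.norm_of_nonneg ht.le]
      _ ≤ ‖M.θstar i‖ + t * (2 * B) := by gcongr
      _ = B := by rw [h2]; ring
  have hrew : M.reward M.ωstar θ' = fun τ =>
      M.rstar i τ + t * (M.rstar i τ - M.reward M.ωstar θ τ) := by
    funext τ
    simp only [θ', reward, rstar, inner_add_right, inner_smul_right, inner_sub_right]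
  have h1 := M.le_of_concentrability_le hC h
    (M.mem_rewardClass M.ωstar (θ := fun _ => θ') fun _ => hθ')
  have hd : M.rewardDist (M.rstar i) (M.reward M.ωstar θ') =
      t ^ 2 * M.rewardDist (M.rstar i) (M.reward M.ωstar θ) := by
    rw [rewardDist, rewardDist, ← expect_const_mul]
    congr 1
    funext τ₀
    rw [← expect_const_mul]
    congr 1
    funext τ₁
    rw [hrew]
    ring
  rw [hd, Real.sqrt_mul (sq_nonneg t), Real.sqrt_sq ht.le, hrew] at h1
  simp only [MDP.J, expect_add, expect_sub, expect_const_mul] at h1 ⊢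
  refine le_of_mul_le_mul_left ?_ ht
  linarith

theorem rewardDist_le_of_close {r r' r'' : Traj S A H → ℝ} {η : ℝ}
    (h : ∀ τ₀ τ₁, |(r' τ₀ - r' τ₁) - (r'' τ₀ - r'' τ₁)| ≤ η) :
    M.rewardDist r r'' ≤ 2 * M.rewardDist r r' + 2 * η ^ 2 := by
  have e : 2 * M.rewardDist r r' + 2 * η ^ 2 = expect M.μ₀ fun τ₀ => expect M.μ₁ fun τ₁ =>
      2 * ((r τ₀ - r τ₁) - (r' τ₀ - r' τ₁)) ^ 2 + 2 * η ^ 2 := by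
    simp only [expect_add, expect_const, expect_const_mul, rewardDist]
  rw [e]
  refine expect_mono _ fun τ₀ => expect_mono _ fun τ₁ => ?_
  have h2 := pow_le_pow_left₀ (abs_nonneg _) (h τ₀ τ₁) 2
  rw [sq_abs] at h2
  nlinarith [sq_nonneg (((r τ₀ - r τ₁) - (r' τ₀ - r' τ₁)) -
    ((r' τ₀ - r' τ₁) - (r'' τ₀ - r'' τ₁)))]

/-- Optimality of `πhat` leaves underestimation at `π` and overestimation at `πhat`. The first costs
`C` times the root distance. The second goes through the nearby reward with the true representation:
`η` for the change, and `C` times a root distance at most twice the original plus `2η`. -/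
theorem regret_le {C η : ℝ} (hC : 0 ≤ C) {i : Fin N} (hi : ‖M.θstar i‖ < B)
    (hconc : ∀ π, M.concentrability (M.rewardClass B) π (M.μref i) i ≤ ENNReal.ofReal C)
    {ω : Ω} {θ θ' : EuclideanSpace ℝ (Fin k)} (hθ : ‖θ‖ ≤ B) (hθ' : ‖θ'‖ ≤ B)
    (hη : 0 ≤ η)
    (hclose : ∀ τ₀ τ₁, |(M.reward ω θ τ₀ - M.reward ω θ τ₁) -
      (M.reward M.ωstar θ' τ₀ - M.reward M.ωstar θ' τ₁)| ≤ η)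
    {π πhat : Policy S A H} (hπ : M.mdp.J π (M.reward ω θ) ≤ M.mdp.J πhat (M.reward ω θ)) :
    M.mdp.J π (M.rstar i) - M.mdp.J πhat (M.rstar i) ≤
      3 * C * √(M.rewardDist (M.rstar i) (M.reward ω θ)) + (2 * C + 1) * η := by
  have h1 := M.le_of_concentrability_le hC (hconc π)
    (M.mem_rewardClass ω (θ := fun _ => θ) fun _ => hθ)
  have h2 := M.neg_le_of_concentrability_le hC hi (hconc πhat) hθ'
  have h3 : (M.mdp.J πhat (M.reward ω θ) - expect (M.μref i) (M.reward ω θ)) -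
      (M.mdp.J πhat (M.reward M.ωstar θ') - expect (M.μref i) (M.reward M.ωstar θ')) ≤ η := by
    rw [← expect_occupancy_sub]
    refine expect_le_of_le _ fun τ₀ => expect_le_of_le _ fun τ₁ => ?_
    have := (abs_le.1 (hclose τ₀ τ₁)).2
    linarith
  have h4 : √(M.rewardDist (M.rstar i) (M.reward M.ωstar θ')) ≤
      2 * √(M.rewardDist (M.rstar i) (M.reward ω θ)) + 2 * η := by
    have hd := M.rewardDist_nonneg (M.rstar i) (M.reward ω θ)
    refine Real.sqrt_le_iff.2 ⟨by positivity, ?_⟩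
    refine (M.rewardDist_le_of_close hclose).trans ?_
    have hs := Real.sq_sqrt hd
    have h0 : 0 ≤ √(M.rewardDist (M.rstar i) (M.reward ω θ)) * η := by positivity
    nlinarith [sq_nonneg η]
  have h5 := mul_le_mul_of_nonneg_left h4 hC
  linarith

/-! ### Uniform convergence of the likelihood -/

/-- Log-likelihood of the whole data set under a reward vector. -/
noncomputable def totalLogLik {Np : ℕ} (D : Dataset S A H N Np) (r : Fin N → Traj S A H → ℝ) : ℝ :=
  ∑ i, ∑ j, Real.log (prefProb M.Φ (r i) (D i j).1 (D i j).2.1 (D i j).2.2)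

/-- Simultaneous concentration of the log-likelihoods and likelihood ratios of finitely many reward
vectors. -/
theorem ofReal_one_sub_le_dataLaw_finite (hR : 0 < R) {L t : ℝ} (hL : 1 + 2 * R * M.Φ.xi R ≤ L)
    {n Np : ℕ} (c : Fin n → Fin N → Traj S A H → ℝ) (hc : ∀ b i τ, |c b i τ| ≤ R)
    {δ : ℝ} (hδ : 0 < δ) (ht : 0 < t) :
    ENNReal.ofReal (1 - δ) ≤ M.dataLaw Np {D | ∀ b,
      (1 / 2) * (M.totalLogLik D (c b) - M.totalLogLik D M.rstar) ≤
        -(Np * ∑ i, M.probDist (M.rstar i) (c b i) / 4) + Real.log (3 * n / δ) ∧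
      t * |M.totalLogLik D (c b) - Np * ∑ i, M.meanLogLik i (c b i)| ≤
        N * Np * (L ^ 2 * t ^ 2 / 2) + Real.log (3 * n / δ)} := by
  let X : Fin n → Fin N → Fin 2 × Traj S A H × Traj S A H → ℝ := fun b i z =>
    Real.log (prefProb M.Φ (c b i) z.1 z.2.1 z.2.2)
  have hX : ∀ b i z, |X b i z| ≤ L := fun b i z =>
    (abs_log_prefProb_le M.Φ hR (hc b i) _ _ _).trans hL
  -- Three exponents for each vector, namely the half log-ratio and the log-likelihood with both
  -- signs; hence `3 * n` in the logarithm.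
  have h := ofReal_one_sub_le_pi (ι := Fin n ⊕ Fin n ⊕ Fin n) (n := Np) M.userLaw
    (Sum.elim (fun b i z => (1 / 2) * (X b i z -
        Real.log (prefProb M.Φ (M.rstar i) z.1 z.2.1 z.2.2)))
      (Sum.elim (fun b i z => t * X b i z) fun b i z => -t * X b i z))
    (Sum.elim (fun b i => -(M.probDist (M.rstar i) (c b i) / 4))
      (Sum.elim (fun b i => t * M.meanLogLik i (c b i) + L ^ 2 * t ^ 2 / 2)
        fun b i => -t * M.meanLogLik i (c b i) + L ^ 2 * (-t) ^ 2 / 2))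
    (by
      rintro (b | b | b) i
      · exact M.expect_exp_half_le i (c b i)
      · exact expect_exp_le_of_abs_le _ (hX b i) t
      · exact expect_exp_le_of_abs_le _ (hX b i) (-t)) hδ
  refine h.trans (MeasureTheory.measure_mono ?_)
  intro D hD b
  have hcard : (Fintype.card (Fin n ⊕ Fin n ⊕ Fin n) : ℝ) = 3 * n := by
    simp only [Fintype.card_sum, Fintype.card_fin]
    push_cast
    ring
  have h0 := hD (Sum.inl b)
  have h1 := hD (Sum.inr (Sum.inl b))
  have h2 := hD (Sum.inr (Sum.inr b))
  simp only [Sum.elim_inl, Sum.elim_inr, hcard, X, ← Finset.mul_sum, Finset.sum_sub_distrib,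
    Finset.sum_neg_distrib, Finset.sum_add_distrib, Finset.sum_const, Finset.card_univ,
    Fintype.card_fin, nsmul_eq_mul] at h0 h1 h2
  refine ⟨by simpa only [totalLogLik, mul_neg] using h0, ?_⟩
  rw [← abs_of_pos ht, ← abs_mul, abs_of_pos ht]
  refine abs_le'.2 ⟨?_, ?_⟩ <;> simp only [totalLogLik] <;> linarith

theorem abs_totalLogLik_sub_le (hR : 0 < R) {L ε : ℝ} (hL : 1 + 2 * R * M.Φ.xi R ≤ L)
    {r r' : Fin N → Traj S A H → ℝ} (hr : ∀ i τ, |r i τ| ≤ R) (hr' : ∀ i τ, |r' i τ| ≤ R)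
    (h : ∀ i o τ₀ τ₁, |prefProb M.Φ (r i) o τ₀ τ₁ - prefProb M.Φ (r' i) o τ₀ τ₁| ≤ ε)
    {Np : ℕ} (D : Dataset S A H N Np) :
    |M.totalLogLik D r - M.totalLogLik D r'| ≤ N * Np * (Real.exp L * ε) ∧
      |∑ i, M.meanLogLik i (r i) - ∑ i, M.meanLogLik i (r' i)| ≤ N * (Real.exp L * ε) := by
  have key : ∀ i o τ₀ τ₁, |Real.log (prefProb M.Φ (r i) o τ₀ τ₁) -
      Real.log (prefProb M.Φ (r' i) o τ₀ τ₁)| ≤ Real.exp L * ε := fun i o τ₀ τ₁ =>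
    (abs_log_sub_log_le_of_exp_le (exp_neg_le_prefProb M.Φ hR (hr i) hL o τ₀ τ₁)
      (exp_neg_le_prefProb M.Φ hR (hr' i) hL o τ₀ τ₁)).trans
      (mul_le_mul_of_nonneg_left (h i o τ₀ τ₁) (Real.exp_pos _).le)
  constructor
  · simp only [totalLogLik, ← Finset.sum_sub_distrib]
    refine (Finset.abs_sum_le_sum_abs _ _).trans ((Finset.sum_le_sum fun i _ =>
      (Finset.abs_sum_le_sum_abs _ _).trans (Finset.sum_le_sum fun j _ => key i _ _ _)).trans ?_)
    simp [mul_assoc]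
  · simp only [meanLogLik, ← Finset.sum_sub_distrib, ← expect_sub]
    refine (Finset.abs_sum_le_sum_abs _ _).trans ((Finset.sum_le_sum fun i _ =>
      abs_expect_le _ fun z => key i _ _ _).trans ?_)
    simp

theorem probDist_le_of_close {r r' r'' : Traj S A H → ℝ} {ε : ℝ}
    (h : ∀ o τ₀ τ₁, |prefProb M.Φ r' o τ₀ τ₁ - prefProb M.Φ r'' o τ₀ τ₁| ≤ ε) :
    M.probDist r r' ≤ 2 * M.probDist r r'' + 2 * ε ^ 2 := by
  have e : 2 * M.probDist r r'' + 2 * ε ^ 2 = expect M.μ₀ fun τ₀ => expect M.μ₁ fun τ₁ =>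
      2 * (M.Φ (r τ₀ - r τ₁) - M.Φ (r'' τ₀ - r'' τ₁)) ^ 2 + 2 * ε ^ 2 := by
    simp only [expect_add, expect_const, expect_const_mul, probDist]
  rw [e]
  refine expect_mono _ fun τ₀ => expect_mono _ fun τ₁ => ?_
  have h1 := h 0 τ₀ τ₁
  rw [prefProb_zero, prefProb_zero] at h1
  have h2 := pow_le_pow_left₀ (abs_nonneg _) h1 2
  rw [sq_abs] at h2
  nlinarith [sq_nonneg ((M.Φ (r τ₀ - r τ₁) - M.Φ (r'' τ₀ - r'' τ₁)) +
    (M.Φ (r' τ₀ - r' τ₁) - M.Φ (r'' τ₀ - r'' τ₁)))]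

/-- With high probability the log-likelihood is close to its mean uniformly over a class, and every
reward vector of the class that is at least as likely as the truth is close to it. -/
theorem ofReal_one_sub_le_dataLaw (hR : 0 < R) {L : ℝ} (hL : 1 + 2 * R * M.Φ.xi R ≤ L)
    {G : Set (Fin N → Traj S A H → ℝ)} (hG : ∀ r ∈ G, ∀ i τ, |r i τ| ≤ R) (hne : G.Nonempty)
    {Np : ℕ} (hN : 0 < N) (hNp : 0 < Np) {δ Λ : ℝ} (hδ : 0 < δ)
    (hΛ : Real.log (3 * bracketingNumber M.Φ G (1 / ((N : ℝ) * Np)) / δ) = Λ) (hΛ1 : 1 ≤ Λ) :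
    ENNReal.ofReal (1 - δ) ≤ M.dataLaw Np {D | ∀ r ∈ G,
      |M.totalLogLik D r - Np * ∑ i, M.meanLogLik i (r i)| ≤
        (L ^ 2 / 2 + 1 + 2 * Real.exp L) * √(N * Np * Λ) ∧
      (M.totalLogLik D M.rstar ≤ M.totalLogLik D r →
        Np * ∑ i, M.probDist (M.rstar i) (r i) ≤ (10 + 4 * Real.exp L) * Λ)} := by
  have hN1 : (1 : ℝ) ≤ N := by exact_mod_cast hN
  have hNp1 : (1 : ℝ) ≤ Np := by exact_mod_cast hNp
  set n₀ : ℝ := N * Np with hn₀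
  have hn₀1 : 1 ≤ n₀ := one_le_mul_of_one_le_of_one_le hN1 hNp1
  have hn₀0 : 0 < n₀ := by linarith
  have hε : 0 < 1 / n₀ := by positivity
  obtain ⟨c, hcG, hc⟩ := exists_net M.Φ G hε hne
  -- This tilt balances the variance term `n₀ t²` against `Λ`. The net has mesh `1 / n₀`, so passing
  -- to it changes a total log-likelihood by at most the constant `exp L`.
  have ht : 0 < √(Λ / n₀) := Real.sqrt_pos.2 (by positivity)
  refine (M.ofReal_one_sub_le_dataLaw_finite hR hL (Np := Np) c
    (fun b => hG _ (hcG b)) hδ ht).trans (MeasureTheory.measure_mono ?_)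
  intro D hD r hr
  obtain ⟨b, hb⟩ := hc r hr
  obtain ⟨h1, h2⟩ := hD b
  rw [hΛ] at h1 h2
  obtain ⟨h3, h4⟩ := M.abs_totalLogLik_sub_le hR hL (hG r hr) (hG _ (hcG b)) hb D
  have hε1 : n₀ * (Real.exp L * (1 / n₀)) = Real.exp L := by field_simp
  rw [← hn₀, hε1] at h3
  have h4' : |Np * ∑ i, M.meanLogLik i (r i) - Np * ∑ i, M.meanLogLik i (c b i)| ≤
      Real.exp L := by
    rw [← mul_sub, abs_mul, Nat.abs_cast]
    refine (mul_le_mul_of_nonneg_left h4 (Nat.cast_nonneg _)).trans (le_of_eq ?_)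
    rw [← mul_assoc, mul_comm (Np : ℝ), ← hn₀, hε1]
  have hs0 : 0 < √(n₀ * Λ) := Real.sqrt_pos.2 (by positivity)
  have hs1 : 1 ≤ √(n₀ * Λ) := Real.one_le_sqrt.2 (one_le_mul_of_one_le_of_one_le hn₀1 hΛ1)
  have hts : √(Λ / n₀) * √(n₀ * Λ) = Λ := by
    rw [← Real.sqrt_mul (by positivity), show Λ / n₀ * (n₀ * Λ) = Λ ^ 2 by field_simp,
      Real.sqrt_sq (by linarith)]
  have ht2 : n₀ * √(Λ / n₀) ^ 2 = Λ := by
    rw [Real.sq_sqrt (by positivity)]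
    field_simp
  have h2' : |M.totalLogLik D (c b) - Np * ∑ i, M.meanLogLik i (c b i)| ≤
      (L ^ 2 / 2 + 1) * √(n₀ * Λ) := by
    refine le_of_mul_le_mul_left (h2.trans (le_of_eq ?_)) ht
    calc n₀ * (L ^ 2 * √(Λ / n₀) ^ 2 / 2) + Λ = L ^ 2 / 2 * (n₀ * √(Λ / n₀) ^ 2) + Λ := by ring
      _ = (L ^ 2 / 2 + 1) * Λ := by rw [ht2]; ring
      _ = √(Λ / n₀) * ((L ^ 2 / 2 + 1) * √(n₀ * Λ)) := by
        nth_rewrite 1 [← hts]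
        ring
  have hexp := Real.exp_pos L
  refine ⟨?_, fun hle => ?_⟩
  · have : 2 * Real.exp L ≤ 2 * Real.exp L * √(n₀ * Λ) := le_mul_of_one_le_right (by positivity) hs1
    rw [abs_le] at *
    constructor <;> linarith
  -- The net point is less likely than the truth by at most `exp L` in log-likelihood, so its
  -- distance is at most `4Λ + 2 exp L`. Returning to `r` doubles this and adds `2`; then `1 ≤ Λ` is
  -- used.
  · have h5 : ∑ i, M.probDist (M.rstar i) (r i) ≤
        ∑ i, (2 * M.probDist (M.rstar i) (c b i) + 2 * (1 / n₀) ^ 2) :=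
      Finset.sum_le_sum fun i _ => M.probDist_le_of_close (hb i)
    rw [Finset.sum_add_distrib, ← Finset.mul_sum, Finset.sum_const, Finset.card_univ,
      Fintype.card_fin, nsmul_eq_mul] at h5
    rw [← Finset.sum_div] at h1
    have h6 := mul_le_mul_of_nonneg_left h5 (Nat.cast_nonneg (α := ℝ) Np)
    have h7 : (Np : ℝ) * (N * (2 * (1 / n₀) ^ 2)) ≤ 2 := by
      have : (Np : ℝ) * (N * (2 * (1 / n₀) ^ 2)) = 2 * (1 / n₀) := by
        rw [hn₀]
        field_simp
      rw [this]
      have := (div_le_one hn₀0).2 hn₀1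
      linarith
    have h8 := (abs_le.1 h3).2
    nlinarith

/-! ### Regret of the clustering algorithm -/

/-- The regret bound on the event that the log-likelihoods are uniformly close to their means and
that the maximum likelihood estimate is close to the truth. -/
theorem sum_regret_le {Np K : ℕ} {c₀ c₁ C V W η : ℝ} (hR : 0 < R) (hB : 0 < B) (hC : 0 ≤ C)
    (hN : 0 < N) (hK : 0 < K) (hNp : 0 < Np)
    (hΦ : ∀ x ∈ Set.Icc (-(2 * R)) (2 * R), 0 < deriv M.Φ x)
    (hbd : ∀ r ∈ M.rewardClass B, ∀ i τ, |r i τ| ≤ R)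
    (hθ : ∀ i, ‖M.θstar i‖ < B) (hdiv : c₀ * N / k ≤ sigmaSq M.θstar)
    (huniq : M.UniqueRep B c₀ c₁)
    (hconc : ∀ π i, M.concentrability (M.rewardClass B) π (M.μref i) i ≤ ENNReal.ofReal C)
    {D : Dataset S A H N Np} (hW0 : 0 < W) (hη : 0 ≤ η)
    (hη2 : c₁ * k * (M.Φ.kappa R ^ 2 * W / (N * Np)) / B ≤ η ^ 2)
    (hV : ∀ r ∈ M.rewardClass B,
      |M.totalLogLik D r - Np * ∑ i, M.meanLogLik i (r i)| ≤ V)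
    (hW : ∀ r ∈ M.rewardClass B, M.totalLogLik D M.rstar ≤ M.totalLogLik D r →
      Np * ∑ i, M.probDist (M.rstar i) (r i) ≤ W)
    {out : ClusterOutput S A Ω H N K k} (hout : M.IsOutput B D out)
    (πtar : Fin N → Policy S A H) :
    ∑ i, (M.mdp.J (πtar i) (M.rstar i) - M.mdp.J (out.π (out.f i)) (M.rstar i)) ≤
      N * (3 * C * (M.Φ.kappa R * √(2 * (∑ i, (1 / (N : ℝ)) * labelDisc M.Φ (M.userLaw i)
        (M.clusterLaw out.f i) (M.fixedRepClass B M.ωstar) + M.Φ.xi R * (B * η)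
        + 2 * V / (N * Np)))) + (2 * C + 1) * (B * η)) := by
  have hN0 : (0 : ℝ) < N := by exact_mod_cast hN
  have hNp0 : (0 : ℝ) < Np := by exact_mod_cast hNp
  have hκ := (M.Φ.one_le_kappa_mul_deriv hR hΦ).1
  have hrs : ∀ i τ, |M.rstar i τ| ≤ R := fun i τ => M.abs_reward_le hN hbd _ (hθ i).le τ
  obtain ⟨P, hP⟩ : ∃ P : EuclideanSpace ℝ (Fin k) ≃ₗᵢ[ℝ] EuclideanSpace ℝ (Fin k),
      ∀ τ₀ τ₁, ‖M.repDiff M.ωstar τ₀ τ₁ - P (M.repDiff out.ω τ₀ τ₁)‖ ≤ η := by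
    obtain ⟨θm, hθm, hmle⟩ := hout.rep
    have hmem := M.mem_rewardClass out.ω hθm
    have h1 := hW _ hmem (hmle M.ωstar M.θstar fun i => (hθ i).le)
    -- Uniqueness is applied with the diverse true parameters on one side and the MLE parameters on
    -- the other; the latter serve only to produce `P`.
    obtain ⟨P, hP⟩ := huniq M.ωstar out.ω (M.Φ.kappa R ^ 2 * W / (N * Np)) (by positivity) N hN
      M.θstar θm hdiv (fun i => (hθ i).le) (by
        simp only [← reward_sub_reward]
        change 1 / (N : ℝ) * ∑ i, M.rewardDist (M.rstar i) (M.reward out.ω (θm i)) ≤ _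
        have h2 : ∑ i, M.rewardDist (M.rstar i) (M.reward out.ω (θm i)) ≤
            M.Φ.kappa R ^ 2 * ∑ i, M.probDist (M.rstar i) (M.reward out.ω (θm i)) := by
          rw [Finset.mul_sum]
          exact Finset.sum_le_sum fun i _ =>
            M.rewardDist_le_probDist hR hΦ (hrs i) (hbd _ hmem i)
        have h3 := mul_le_mul_of_nonneg_left h1 (sq_nonneg (M.Φ.kappa R))
        rw [one_div, inv_mul_le_iff₀ hN0, ← mul_div_assoc, mul_div_mul_left _ _ hN0.ne',
          le_div_iff₀ hNp0]
        refine (mul_le_mul_of_nonneg_right h2 hNp0.le).trans (le_of_eq_of_le ?_ h3)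
        ring)
    exact ⟨P, fun τ₀ τ₁ => abs_le_of_sq_le_sq' ((hP τ₀ τ₁).trans hη2) hη |>.2⟩
  have hclose : ∀ {θ : EuclideanSpace ℝ (Fin k)}, ‖θ‖ ≤ B → ∀ τ₀ τ₁,
      |(M.reward out.ω θ τ₀ - M.reward out.ω θ τ₁) -
        (M.reward M.ωstar (P θ) τ₀ - M.reward M.ωstar (P θ) τ₁)| ≤ B * η :=
    fun hθ => M.abs_reward_sub_le_of_close hη hP hθ
  obtain ⟨s, hs⟩ := M.exists_representatives hR hN hbd (fun i => (hθ i).le) out.f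
  set disc : Fin N → ℝ := fun i =>
    labelDisc M.Φ (M.userLaw i) (M.clusterLaw out.f i) (M.fixedRepClass B M.ωstar)
  have hθ' : ∀ l, ‖P.symm (M.θstar (s l))‖ ≤ B := fun l => by
    rw [P.symm.norm_map]
    exact (hθ _).le
  -- The competitor gives each cluster its representative's true parameter, pulled back to the
  -- learned representation.
  have hlik : M.totalLogLik D (fun i => M.reward out.ω (P.symm (M.θstar (s (out.f i))))) ≤
      M.totalLogLik D (fun i => M.reward out.ω (out.θ (out.f i))) := by
    have : Nonempty (Fin K) := ⟨⟨0, hK⟩⟩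
    calc _ ≤ ∑ i, ⨆ l, M.logLik D i out.ω (P.symm (M.θstar (s l))) :=
          Finset.sum_le_sum fun i _ => le_ciSup
            (f := fun l => M.logLik D i out.ω (P.symm (M.θstar (s l))))
            (Set.finite_range _).bddAbove (out.f i)
      _ ≤ ∑ i, ⨆ l, M.logLik D i out.ω (out.θ l) := hout.optimal _ hθ'
      _ ≤ _ := Finset.sum_le_sum fun i _ => ciSup_le (hout.assign i)
  have hmem' := M.mem_rewardClass (N := N) out.ω
    (θ := fun i => P.symm (M.θstar (s (out.f i)))) fun i => hθ' _
  have hmem := M.mem_rewardClass (N := N) out.ω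
    (θ := fun i => out.θ (out.f i)) fun i => hout.feasible _
  have htrans : ∑ i, M.meanLogLik i (M.rstar (s (out.f i))) -
      ∑ i, M.meanLogLik i (M.reward out.ω (P.symm (M.θstar (s (out.f i))))) ≤
      N * (M.Φ.xi R * (B * η)) := by
    rw [← Finset.sum_sub_distrib]
    refine (Finset.sum_le_sum (g := fun _ => M.Φ.xi R * (B * η)) fun i _ => ?_).trans
      (le_of_eq (by simp))
    rw [meanLogLik, meanLogLik, ← expect_sub]
    refine expect_le_of_le _ fun z => (le_abs_self _).trans ?_
    refine (abs_log_prefProb_sub_le M.Φ (hrs _) (hbd _ hmem' i) _ _ _).trans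
      (mul_le_mul_of_nonneg_left ?_ (M.Φ.xi_nonneg hR))
    rw [abs_sub_comm]
    have h := hclose (hθ' (out.f i)) z.2.1 z.2.2
    rw [P.apply_symm_apply] at h
    exact h
  have hkl : ∑ i, M.meanLogLik i (M.rstar i) -
      ∑ i, M.meanLogLik i (M.reward out.ω (out.θ (out.f i))) ≤
      N * (∑ i, (1 / (N : ℝ)) * disc i + M.Φ.xi R * (B * η) + 2 * V / (N * Np)) := by
    have h1 := (abs_le.1 (hV _ hmem')).1
    have h2 := (abs_le.1 (hV _ hmem)).2
    have h3 : ∑ i, M.meanLogLik i (M.reward out.ω (P.symm (M.θstar (s (out.f i))))) -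
        ∑ i, M.meanLogLik i (M.reward out.ω (out.θ (out.f i))) ≤ 2 * V / Np := by
      rw [le_div_iff₀ hNp0, sub_mul, mul_comm _ (Np : ℝ), mul_comm _ (Np : ℝ)]
      linarith
    have h4 : N * (∑ i, (1 / (N : ℝ)) * disc i + M.Φ.xi R * (B * η) + 2 * V / (N * Np)) =
        ∑ i, disc i + N * (M.Φ.xi R * (B * η)) + 2 * V / Np := by
      rw [← Finset.mul_sum]
      field_simp
    linarith
  set E := ∑ i, (1 / (N : ℝ)) * disc i + M.Φ.xi R * (B * η) + 2 * V / (N * Np)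
  have hdist : ∑ i, M.rewardDist (M.rstar i) (M.reward out.ω (out.θ (out.f i))) ≤
      M.Φ.kappa R ^ 2 * (2 * (N * E)) := by
    refine le_trans ?_ (mul_le_mul_of_nonneg_left
      (mul_le_mul_of_nonneg_left hkl zero_le_two) (sq_nonneg _))
    rw [← Finset.sum_sub_distrib, Finset.mul_sum, Finset.mul_sum]
    exact Finset.sum_le_sum fun i _ =>
      (M.rewardDist_le_probDist hR hΦ (hrs i) (hbd _ hmem i)).trans
        (mul_le_mul_of_nonneg_left (M.probDist_le_meanLogLik_sub i _) (sq_nonneg _))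
  have hsqrt : ∑ i, √(M.rewardDist (M.rstar i) (M.reward out.ω (out.θ (out.f i)))) ≤
      N * (M.Φ.kappa R * √(2 * E)) := by
    -- The right-hand side is written as a root to match Cauchy–Schwarz over the `N` users.
    have h1 : N * (M.Φ.kappa R * √(2 * E)) = √(N * (M.Φ.kappa R ^ 2 * (2 * (N * E)))) := by
      rw [show N * (M.Φ.kappa R ^ 2 * (2 * (N * E))) = (N * M.Φ.kappa R) ^ 2 * (2 * E) by ring,
        Real.sqrt_mul (sq_nonneg _), Real.sqrt_sq (by positivity), mul_assoc]
    rw [h1]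
    refine Real.le_sqrt_of_sq_le (sq_sum_le_card_mul_sum_sq.trans ?_)
    simp only [Real.sq_sqrt (M.rewardDist_nonneg _ _), Finset.card_univ, Fintype.card_fin]
    exact mul_le_mul_of_nonneg_left hdist hN0.le
  have hreg := Finset.sum_le_sum fun i (_ : i ∈ Finset.univ) =>
    M.regret_le hC (hθ i) (fun π => hconc π i) (hout.feasible (out.f i))
      ((P.norm_map _).trans_le (hout.feasible (out.f i))) (by positivity)
      (hclose (hout.feasible (out.f i))) (π := πtar i) (πhat := out.π (out.f i))
      (by linarith [hout.policy (out.f i) (πtar i)])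
  refine hreg.trans ?_
  rw [Finset.sum_add_distrib, ← Finset.mul_sum, Finset.sum_const, Finset.card_univ,
    Fintype.card_fin, nsmul_eq_mul]
  have := mul_le_mul_of_nonneg_left hsqrt (show 0 ≤ 3 * C by positivity)
  linarith

/-- If a single bracket of width `ε` covers the class then the true rewards are almost constant. -/
theorem rstar_sub_le_of_bracketingNumber_eq_one {ε : ℝ} (hR : 0 < R) (hB : 0 < B)
    (hε : 0 < ε) (hΦ : ∀ x ∈ Set.Icc (-(2 * R)) (2 * R), 0 < deriv M.Φ x)
    (hbd : ∀ r ∈ M.rewardClass B, ∀ i τ, |r i τ| ≤ R)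
    (hθ : ∀ i, ‖M.θstar i‖ < B) (h : bracketingNumber M.Φ (M.rewardClass B) ε = 1)
    (i : Fin N) (τ₀ τ₁ : Traj S A H) :
    M.rstar i τ₀ - M.rstar i τ₁ ≤ M.Φ.kappa R * (2 * ε) := by
  have hmem := M.mem_rewardClass M.ωstar (θ := M.θstar) fun i => (hθ i).le
  have hmem0 := M.mem_rewardClass (N := N) M.ωstar (θ := fun _ => 0) fun _ => by simpa using hB.le
  obtain ⟨c, -, hc⟩ := exists_net M.Φ (M.rewardClass B) hε ⟨_, hmem⟩
  obtain ⟨b, hb⟩ := hc _ hmem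
  obtain ⟨b', hb'⟩ := hc _ hmem0
  -- The zero reward, which has no differences, also belongs to the class, so it shares the only net
  -- point with the truth.
  obtain rfl : b = b' := Fin.ext (by omega)
  have h1 := hb i 0 τ₀ τ₁
  have h2 := hb' i 0 τ₀ τ₁
  have h3 := M.Φ.abs_sub_le_kappa_mul hR hΦ (sub_mem_Icc (hbd _ hmem i) τ₀ τ₁)
    (sub_mem_Icc (hbd _ hmem0 i) τ₀ τ₁)
  rw [prefProb_zero] at h1 h2
  have h4 := (abs_sub_le _ _ _).trans (add_le_add h1 ((abs_sub_comm _ _).trans_le h2))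
  have h5 := mul_le_mul_of_nonneg_left h4 (M.Φ.one_le_kappa_mul_deriv hR hΦ).1.le
  have h6 := (le_abs_self _).trans (h3.trans h5)
  simp only [reward, inner_zero_right, sub_zero] at h6
  simp only [rstar, reward]
  linarith

end Model

/-- The elementary inequality that combines the statistical error `q` with the discrepancy `d`. -/
theorem sqrt_add_mul_le_rpow {d q a S : ℝ} (hd : 0 ≤ d) (hq : 0 ≤ q) (hq1 : q ≤ 1)
    (ha : 0 ≤ a) (hS : d ^ 2 + q ^ 2 / 3 ≤ S) :
    √(2 * (d + a * q)) ≤ 2 * √(2 * (1 + a)) * S ^ (1 / 4 : ℝ) ∧ q ≤ 2 * S ^ (1 / 4 : ℝ) := by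
  have hS0 : 0 ≤ S := le_trans (by positivity) hS
  have h4 : (S ^ (1 / 4 : ℝ)) ^ 4 = S := by
    rw [← Real.rpow_natCast, ← Real.rpow_mul hS0]
    norm_num
  have hs : 0 ≤ S ^ (1 / 4 : ℝ) := by positivity
  set s := S ^ (1 / 4 : ℝ)
  have h1 : d + q ≤ 4 * s ^ 2 := by
    refine le_of_sq_le_sq ?_ (by positivity)
    nlinarith [sq_nonneg (d - q)]
  constructor
  · refine Real.sqrt_le_iff.2 ⟨by positivity, ?_⟩
    rw [mul_pow, mul_pow, Real.sq_sqrt (by positivity)]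
    nlinarith [mul_nonneg ha hd, mul_le_mul_of_nonneg_left h1 (show 0 ≤ 2 * (1 + a) by positivity)]
  · refine le_of_sq_le_sq ?_ (by positivity)
    nlinarith

theorem le_rpow_quarter {u S : ℝ} (hu : 0 ≤ u) (h : u ^ 4 ≤ S) : u ≤ S ^ (1 / 4 : ℝ) := by
  have h1 := Real.rpow_le_rpow (by positivity) h (show (0 : ℝ) ≤ 1 / 4 by norm_num)
  rwa [← Real.rpow_natCast, ← Real.rpow_mul hu, show ((4 : ℕ) : ℝ) * (1 / 4) = 1 by norm_num,
    Real.rpow_one] at h1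

end PersonalizedRLHF

/-! ### Choice of the constant and the case distinction -/

set_option maxHeartbeats 1000000 in
open PersonalizedRLHF in
theorem mainTheorem2 (R B ξmax Cmax c₀ c₁ : ℝ)
    (hR : 0 < R) (hB : 0 < B) (hc₀ : 0 < c₀) (hc₁ : 0 < c₁) :
    ∃ c : ℝ, 0 < c ∧
      ∀ (S A Ω : Type*) [Fintype S] [Fintype A] (H N Np K d k : ℕ),
      0 < N → 0 < K → 0 < k → k ≤ Np →
      ∀ M : PersonalizedRLHF.Model S A Ω H N d k,
      -- the link function is increasing on the relevant interval, and `ξ ≤ ξmax`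
      (∀ x ∈ Set.Icc (-(2 * R)) (2 * R), 0 < deriv M.Φ x) →
      M.Φ.xi R ≤ ξmax →
      -- rewards are bounded
      (∀ r ∈ M.rewardClass B, ∀ i τ, |r i τ| ≤ R) →
      -- realizability
      (∀ i, ‖M.θstar i‖ < B) →
      -- diversity
      c₀ * N / k ≤ PersonalizedRLHF.sigmaSq M.θstar →
      -- uniqueness of the representation
      M.UniqueRep B c₀ c₁ →
      -- uniform concentration of covariances
      M.UniformConcentration →
      -- uniformly bounded concentrability coefficients
      (∀ π i, M.concentrability (M.rewardClass B) π (M.μref i) i ≤ ENNReal.ofReal Cmax) →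
      ∀ (πtar : Fin N → PersonalizedRLHF.Policy S A H) (δ : ℝ), 0 < δ → δ ≤ 1 →
      ENNReal.ofReal (1 - δ) ≤ M.dataLaw Np
        {D | ∀ out : PersonalizedRLHF.ClusterOutput S A Ω H N K k, M.IsOutput B D out →
          ∑ i, (M.mdp.J (πtar i) (M.rstar i) - M.mdp.J (out.π (out.f i)) (M.rstar i)) ≤
            c * M.boundRHS Np R B δ out.f} := by
  set L : ℝ := 1 + 2 * R * |ξmax| with hLdef
  set C : ℝ := max Cmax 0
  set CV : ℝ := L ^ 2 / 2 + 1 + 2 * Real.exp L with hCV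
  set CW : ℝ := 10 + 4 * Real.exp L with hCW
  have hexp := Real.exp_pos L
  have hC : 0 ≤ C := le_max_right _ _
  have hCV0 : 0 < CV := by positivity
  have hCW0 : 0 < CW := by positivity
  set a : ℝ := √(c₁ * CW / B) with hadef
  have ha : 0 ≤ a := Real.sqrt_nonneg _
  -- The `4` covers the single-bracket case and `q > 1`; the rest is what `Model.sum_regret_le`
  -- gives once both errors are written in terms of `q`.
  set c : ℝ := 4 + (3 * C * (2 * √(2 * (1 + (B * a + 2 * CV)))) + (2 * C + 1) * (B * a) * 2)
    with hcdef
  have hc4 : 4 ≤ c := by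
    have : 0 ≤ 3 * C * (2 * √(2 * (1 + (B * a + 2 * CV)))) + (2 * C + 1) * (B * a) * 2 := by
      positivity
    linarith
  refine ⟨c, by linarith, ?_⟩
  intro S A Ω _ _ H N Np K d k hN hK hk hkNp M hΦ hξ hbd hθ hdiv huniq _ hconc πtar δ hδ hδ1
  have hNp : 0 < Np := hk.trans_le hkNp
  have hN1 : (1 : ℝ) ≤ N := by exact_mod_cast hN
  have hNp1 : (1 : ℝ) ≤ Np := by exact_mod_cast hNp
  have hk1 : (1 : ℝ) ≤ k := by exact_mod_cast hk
  have hK1 : (1 : ℝ) ≤ K := by exact_mod_cast hK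
  have hN0 : (0 : ℝ) < N := by linarith
  have hNp0 : (0 : ℝ) < Np := by linarith
  have hk0 : (0 : ℝ) < k := by linarith
  have hκ := (M.Φ.one_le_kappa_mul_deriv hR hΦ).1
  have hκR := M.Φ.four_mul_le_kappa hR hΦ
  have hξκ := M.Φ.one_le_xi_mul_kappa hR hΦ
  have hξ0 := M.Φ.xi_nonneg hR
  set κ := M.Φ.kappa R
  set ξ := M.Φ.xi R
  have hL : 1 + 2 * R * ξ ≤ L := by
    have := hξ.trans (le_abs_self _)
    rw [hLdef]
    gcongr
  have hrs : ∀ i τ, |M.rstar i τ| ≤ R := fun i τ => M.abs_reward_le hN hbd _ (hθ i).le τ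
  have hε : (0 : ℝ) < 1 / (N * Np) := by positivity
  have hne : (M.rewardClass B).Nonempty := ⟨_, M.mem_rewardClass M.ωstar fun i => (hθ i).le⟩
  have hn := bracketingNumber_pos M.Φ (M.rewardClass B) hε hne
  set n := bracketingNumber M.Φ (M.rewardClass B) (1 / ((N : ℝ) * Np)) with hndef
  have hn1 : (1 : ℝ) ≤ n := by exact_mod_cast hn
  have hlogδ : ∀ x : ℝ, 1 ≤ x → 0 ≤ Real.log (x / δ) := fun x hx =>
    Real.log_nonneg ((one_le_div hδ).2 (hδ1.trans hx))
  have hlogn := hlogδ n hn1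
  set y : ℝ := k * ξ ^ 2 * κ ^ 2 * Real.log (n / δ) / (N * Np) with hy
  let disc : (Fin N → Fin K) → ℝ := fun f => ∑ i, (1 / (N : ℝ)) *
    labelDisc M.Φ (M.userLaw i) (M.clusterLaw f i) (M.fixedRepClass B M.ωstar)
  have hdisc : ∀ f, 0 ≤ disc f := fun f => Finset.sum_nonneg fun i _ =>
    mul_nonneg (by positivity) (Model.labelDisc_nonneg _ _ _ _)
  have hRHS : ∀ f : Fin N → Fin K, ∃ s, M.boundRHS Np R B δ f = N * κ * s ^ (1 / 4 : ℝ) ∧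
      y + disc f ^ 2 ≤ s ∧ 1 / (2 * Np) ≤ s := by
    intro f
    refine ⟨_, rfl, ?_⟩
    have h1 : 1 / (2 * (Np : ℝ)) ≤ Real.log (2 * K / δ) / Np := by
      rw [← div_div]
      refine div_le_div_of_nonneg_right ?_ hNp0.le
      have h2 : (2 : ℝ) ≤ 2 * K / δ := by
        rw [le_div_iff₀ hδ]
        linarith
      have := Real.log_le_log (by norm_num) h2
      linarith [Real.log_two_gt_d9]
    have h2 : 0 ≤ k * K * Real.log ((Np : ℝ) / k) / Np := by
      have : 0 ≤ Real.log ((Np : ℝ) / k) :=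
        Real.log_nonneg ((one_le_div hk0).2 (by exact_mod_cast hkNp))
      positivity
    have h3 : 0 ≤ y := by positivity
    have h4 : 0 < 1 / (2 * (Np : ℝ)) := by positivity
    have h5 := sq_nonneg (disc f)
    have h6 := sq_nonneg (Real.log (bracketingNumber M.Φ (M.fixedRepClassVec B M.ωstar)
          (1 / ((N : ℝ) * Np)) / δ) / (N * Np))
    constructor <;> linarith
  -- For `n = 1` and `δ = 1` the term `y` vanishes while `Λ` does not, so this case is settled
  -- deterministically. For `n ≥ 2`, `Λ ≤ 3 log (n / δ)`.
  rcases Nat.lt_or_ge n 2 with hn2 | hn2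
  · have hall : {D : Dataset S A H N Np | ∀ out : ClusterOutput S A Ω H N K k,
        M.IsOutput B D out →
        ∑ i, (M.mdp.J (πtar i) (M.rstar i) - M.mdp.J (out.π (out.f i)) (M.rstar i)) ≤
            c * M.boundRHS Np R B δ out.f} = Set.univ := by
      refine Set.eq_univ_of_forall fun D out _ => ?_
      obtain ⟨s, hs, -, hs2⟩ := hRHS out.f
      have h1 := Finset.sum_le_sum fun i (_ : i ∈ Finset.univ) =>
        M.mdp.J_sub_J_le (πtar i) (out.π (out.f i))
          (M.rstar_sub_le_of_bracketingNumber_eq_one hR hB hε hΦ hbd hθ (by omega) i)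
      refine h1.trans ?_
      rw [hs, Finset.sum_const, Finset.card_univ, Fintype.card_fin, nsmul_eq_mul]
      have hu0 : (0 : ℝ) < 1 / Np := by positivity
      have hu1 : 1 / (Np : ℝ) ≤ 1 := (div_le_one hNp0).2 hNp1
      have h2 : 1 / (Np : ℝ) / 2 ≤ s ^ (1 / 4 : ℝ) := by
        refine le_rpow_quarter (by positivity) (le_trans ?_ hs2)
        rw [show 1 / (2 * (Np : ℝ)) = 1 / (Np : ℝ) / 2 by field_simp]
        have : (1 / (Np : ℝ) / 2) ^ 4 ≤ (1 / (Np : ℝ) / 2) ^ 1 :=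
          pow_le_pow_of_le_one (by positivity) (by linarith) (by norm_num)
        simpa using this
      have h3 : 1 / ((N : ℝ) * Np) ≤ 1 / Np := by
        rw [← div_div]
        exact div_le_div_of_nonneg_right ((div_le_one hN0).2 hN1) hNp0.le
      have h4 : 2 * (1 / ((N : ℝ) * Np)) ≤ 4 * s ^ (1 / 4 : ℝ) := by linarith
      calc (N : ℝ) * (κ * (2 * (1 / (N * Np)))) ≤ N * (κ * (4 * s ^ (1 / 4 : ℝ))) := by
            exact mul_le_mul_of_nonneg_left (mul_le_mul_of_nonneg_left h4 hκ.le) hN0.le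
        _ = 4 * (N * κ * s ^ (1 / 4 : ℝ)) := by ring
        _ ≤ c * (N * κ * s ^ (1 / 4 : ℝ)) := by
            have : 0 ≤ s ^ (1 / 4 : ℝ) := le_trans (by positivity) h2
            gcongr
    rw [hall]
    have : MeasureTheory.IsProbabilityMeasure (M.dataLaw Np) := by
      unfold Model.dataLaw
      infer_instance
    rw [MeasureTheory.measure_univ, ← ENNReal.ofReal_one]
    exact ENNReal.ofReal_le_ofReal (by linarith)
  have hn2' : (2 : ℝ) ≤ n := by exact_mod_cast hn2
  set Λ := Real.log (3 * n / δ) with hΛ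
  have hlog2 : Real.log 2 ≤ Real.log (n / δ) := Real.log_le_log (by norm_num) (by
    rw [le_div_iff₀ hδ]
    linarith)
  have hΛ3 : Λ ≤ 3 * Real.log (n / δ) := by
    rw [hΛ, mul_div_assoc, Real.log_mul (by norm_num) (by positivity)]
    have : Real.log 3 ≤ 2 * Real.log 2 := by
      rw [← Real.log_rpow (by norm_num)]
      exact Real.log_le_log (by norm_num) (by norm_num)
    linarith
  have hΛ1 : 1 ≤ Λ := by
    rw [hΛ, Real.le_log_iff_exp_le (by positivity), le_div_iff₀ hδ]
    have h1 := Real.exp_one_lt_d9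
    have h2 := mul_le_of_le_one_right (Real.exp_pos 1).le hδ1
    linarith
  refine (M.ofReal_one_sub_le_dataLaw hR hL hbd hne hN hNp hδ rfl hΛ1).trans
    (MeasureTheory.measure_mono ?_)
  intro D hD out hout
  obtain ⟨s, hs, hs1, -⟩ := hRHS out.f
  rw [hs]
  have hy0 : 0 ≤ y := by positivity
  have hs0 : 0 ≤ s := le_trans (by positivity) hs1
  set n₀ : ℝ := N * Np with hn₀
  have hn₀0 : 0 < n₀ := by positivity
  set x : ℝ := Λ / n₀ with hx
  have hx0 : 0 < x := by positivity
  set q : ℝ := √(k * ξ ^ 2 * κ ^ 2 * x) with hq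
  have hq0 : 0 ≤ q := Real.sqrt_nonneg _
  have hqsq : q ^ 2 = k * ξ ^ 2 * κ ^ 2 * x := Real.sq_sqrt (by positivity)
  have hqy : q ^ 2 / 3 ≤ y := by
    rw [hqsq, hx, hy]
    have : k * ξ ^ 2 * κ ^ 2 * (Λ / n₀) / 3 = k * ξ ^ 2 * κ ^ 2 * (Λ / 3) / n₀ := by ring
    rw [this]
    gcongr
    linarith
  rcases lt_or_ge 1 q with hq1 | hq1
  · have h1 := Finset.sum_le_sum fun i (_ : i ∈ Finset.univ) =>
      M.mdp.J_sub_J_le (πtar i) (out.π (out.f i)) (r := M.rstar i) (c := 2 * R)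
        fun τ₀ τ₁ => (sub_mem_Icc (hrs i) τ₀ τ₁).2
    refine h1.trans ?_
    rw [Finset.sum_const, Finset.card_univ, Fintype.card_fin, nsmul_eq_mul]
    have h2 : 1 / 2 ≤ s ^ (1 / 4 : ℝ) := by
      refine le_rpow_quarter (by norm_num) (le_trans ?_ hs1)
      have h3 : 1 < q ^ 2 := one_lt_pow₀ hq1 two_ne_zero
      linarith [sq_nonneg (disc out.f)]
    have h3 : 2 * R ≤ κ * s ^ (1 / 4 : ℝ) := by
      have := mul_le_mul_of_nonneg_left h2 hκ.le
      linarith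
    calc (N : ℝ) * (2 * R) ≤ N * (κ * s ^ (1 / 4 : ℝ)) := mul_le_mul_of_nonneg_left h3 hN0.le
      _ = 1 * (N * κ * s ^ (1 / 4 : ℝ)) := by ring
      _ ≤ c * (N * κ * s ^ (1 / 4 : ℝ)) := by
          have : 0 ≤ s ^ (1 / 4 : ℝ) := le_trans (by positivity) h2
          gcongr
          linarith
  -- With this value of `a`, the uniqueness bound equals `η ^ 2` exactly.
  set η : ℝ := a * (κ * √(k * x)) with hη
  have hη0 : 0 ≤ η := by positivity
  have hξη : ξ * η = a * q := by
    rw [hη, hq, show k * ξ ^ 2 * κ ^ 2 * x = (ξ * κ) ^ 2 * (k * x) by ring,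
      Real.sqrt_mul (sq_nonneg _), Real.sqrt_sq (by positivity)]
    ring
  have hηq : η ≤ κ * (a * q) := by
    rw [← hξη]
    calc η = 1 * η := (one_mul η).symm
      _ ≤ (ξ * κ) * η := by gcongr
      _ = κ * (ξ * η) := by ring
  have hxq : √x ≤ q := by
    refine Real.sqrt_le_sqrt ?_
    have h1 : 1 ≤ (ξ * κ) ^ 2 := one_le_pow₀ hξκ
    calc x = 1 * 1 * x := by ring
      _ ≤ k * (ξ * κ) ^ 2 * x := by gcongr
      _ = k * ξ ^ 2 * κ ^ 2 * x := by ring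
  have hV : 2 * (CV * √(N * Np * Λ)) / (N * Np) = 2 * CV * √x := by
    rw [← hn₀, hx, show n₀ * Λ = n₀ ^ 2 * (Λ / n₀) by field_simp,
      Real.sqrt_mul (sq_nonneg _), Real.sqrt_sq hn₀0.le]
    field_simp
  have hmain := M.sum_regret_le (η := η) (V := CV * √(N * Np * Λ)) (W := CW * Λ) hR hB hC hN hK
    hNp hΦ hbd hθ hdiv huniq
    (fun π i => (hconc π i).trans (ENNReal.ofReal_le_ofReal (le_max_left _ _)))
    (by positivity) hη0 (by
      rw [hη, mul_pow, mul_pow, hadef, Real.sq_sqrt (by positivity),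
        Real.sq_sqrt (by positivity), hx, hn₀]
      refine le_of_eq ?_
      ring)
    (fun r hr => (hD r hr).1) (fun r hr => (hD r hr).2) hout πtar
  refine hmain.trans ?_
  change N * (3 * C * (κ * √(2 * (disc out.f + ξ * (B * η) +
    2 * (CV * √(N * Np * Λ)) / (N * Np)))) + (2 * C + 1) * (B * η)) ≤ _
  rw [hV]
  obtain ⟨h1, h2⟩ := sqrt_add_mul_le_rpow (d := disc out.f) (q := q) (a := B * a + 2 * CV) (S := s)
    (hdisc _) hq0 hq1 (by positivity) (by linarith)
  have h3 : √(2 * (disc out.f + ξ * (B * η) + 2 * CV * √x)) ≤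
      2 * √(2 * (1 + (B * a + 2 * CV))) * s ^ (1 / 4 : ℝ) := by
    refine le_trans (Real.sqrt_le_sqrt ?_) h1
    have e : ξ * (B * η) = B * (a * q) := by rw [← hξη]; ring
    rw [e]
    have := mul_le_mul_of_nonneg_left hxq (show 0 ≤ 2 * CV by positivity)
    linarith
  have hs4 : 0 ≤ s ^ (1 / 4 : ℝ) := by positivity
  calc N * (3 * C * (κ * √(2 * (disc out.f + ξ * (B * η) + 2 * CV * √x))) +
        (2 * C + 1) * (B * η))
      ≤ N * (3 * C * (κ * (2 * √(2 * (1 + (B * a + 2 * CV))) * s ^ (1 / 4 : ℝ))) +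
        (2 * C + 1) * (B * (κ * (a * (2 * s ^ (1 / 4 : ℝ)))))) := by
        have : κ * (a * q) ≤ κ * (a * (2 * s ^ (1 / 4 : ℝ))) := by gcongr
        have := hηq.trans this
        gcongr
    _ = (c - 4) * (N * κ * s ^ (1 / 4 : ℝ)) := by
        rw [hcdef]
        ring
    _ ≤ c * (N * κ * s ^ (1 / 4 : ℝ)) := by
        gcongr
        linarith
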